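/- Let $p,q\ge 2$ be integers with $pq\ge 6$, and write $\langle p,q\rangle=\mathrm{lcm}(p,q)$, $(p,q)=\gcd(p,q)$. A hypermap on a set $D$ of $n$ darts is a pair of permutations $\alpha,\sigma$ of $D$ such that $\langle\alpha,\sigma\rangle$ acts transitively on $D$; it is a $(p,q)$-hypermap if all cycles of $\alpha$ have length $p$ and all cycles of $\varphi=\sigma^{-1}\alpha^{-1}$ (permutations being multiplied from left to right) have length $q$. It is rooted if one dart is marked as the root; an isomorphism of rooted hypermaps is a bijection of the darts that conjugates $\alpha$ and $\sigma$ of one into those of the other and maps root to root. Let $|\mathfrak H^r_{p,q}(n)|$ be the number of (connected, oriented) rooted $(p,q)$-hypermaps on $n$ darts up to isomorphism, and let $$H^\circ(z)=\sum_{n\ge 0}|\mathfrak H^r_{p,q}(n)|\,z^n .$$ Put $$I=\Big\{\,1\le i\le \tfrac{pq}{(p,q)}-1 \;:\; p\nmid i,\ q\nmid i\Big\},\qquad a_i=\frac{i\,(p,q)}{pq}\quad (i\in I),\qquad N=|I|,$$ let $c=\langle p,q\rangle^{((p-1)(q-1)-1)/(p,q)}$, and let $$f(x)={}_NF_0\big[(a_i)_{i\in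 I};\,x\big]=\sum_{k\ge 0}\Big(\prod_{i\in I}(a_i)_k\Big)\frac{x^k}{k!},\qquad (a)_k=a(a+1)\cdots(a+k-1).$$ Then: (1) $N=1+\frac{(p-1)(q-1)-1}{(p,q)}$, and $c>0$ satisfies $c^{(p,q)}=\langle p,q\rangle^{(p-1)(q-1)-1}$. (2) $f(0)=1$, and $f$ has radius of convergence $0$. (3) As formal power series, $$H^\circ(z)=\langle p,q\rangle\;x\,\frac{f'(x)}{f(x)},\qquad x=c\,z^{\langle p,q\rangle}.$$ (4) $H^\circ(z)$ is transcendental, that is, not algebraic over $\mathbb C[z]$. (5) $[z^n]H^\circ(z)\neq 0$ if and only if $n=\langle p,q\rangle k$ for some integer $k\ge 1$, and $$[z^{\langle p,q\rangle k}]H^\circ(z)\;\sim\; C\,k^{(N-1)k-c_0}\,e^{c_1k}\qquad (k\to\infty),$$ where $$C=\frac{(2\pi)^{\frac{N-1}{2}}\,\langle p,q\rangle}{\prod_{i\in I}\Gamma(a_i)},\qquad c_0=\frac{N-1}{2}-\sum_{i\in I}a_i,\qquad c_1=1+\log c-N .$$ -/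

import Mathlib

noncomputable section

namespace PQHypermap

/-- An oriented labelled combinatorial hypermap on the set of darts `D`: two permutations
`α`, `σ` of `D` such that the group `⟨α, σ⟩` acts transitively on `D`
(so every hypermap is connected). -/
structure Hypermap (D : Type*) where
  α : Equiv.Perm D
  σ : Equiv.Perm D
  transitive : MulAction.IsPretransitive (Subgroup.closure {α, σ}) D

/-- The permutation `φ = σ⁻¹ α⁻¹`, whose cycles are the hyper-faces. Permutations are multiplied
from left to right in that formula (first `σ⁻¹`, then `α⁻¹`); in Mathlib the right factor
acts first. -/
def Hypermap.φ {D : Type*} (H : Hypermap D) : Equiv.Perm D :=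
  H.α⁻¹ * H.σ⁻¹

/-- All cycles of `π` (fixed points counting as cycles of length `1`) have length `l`. -/
def AllCyclesOfLength {D : Type*} (π : Equiv.Perm D) (l : ℕ) : Prop :=
  ∀ x : D, Function.minimalPeriod π x = l

/-- A `(p, q)`-hypermap: all hyper-edges are `p`-gons and all hyper-faces are `q`-gons. -/
def Hypermap.IsPQ {D : Type*} (H : Hypermap D) (p q : ℕ) : Prop :=
  AllCyclesOfLength H.α p ∧ AllCyclesOfLength H.φ q

/-- A rooted hypermap: a hypermap with a marked dart. -/
structure RootedHypermap (D : Type*) extends Hypermap D where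
  root : D

/-- Isomorphism of rooted hypermaps: a bijection of the darts which conjugates the permutations
into each other and maps root to root. -/
def RootedHypermap.Iso {D : Type*} (H₁ H₂ : RootedHypermap D) : Prop :=
  ∃ ψ : Equiv.Perm D, ψ * H₁.α * ψ⁻¹ = H₂.α ∧ ψ * H₁.σ * ψ⁻¹ = H₂.σ ∧ ψ H₁.root = H₂.root

theorem RootedHypermap.Iso.equivalence {D : Type*} :
    Equivalence (RootedHypermap.Iso (D := D)) where
  refl H := ⟨1, by simp, by simp, by simp⟩
  symm := by
    rintro H₁ H₂ ⟨ψ, h1, h2, h3⟩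
    refine ⟨ψ⁻¹, ?_, ?_, ?_⟩
    · rw [← h1]; group
    · rw [← h2]; group
    · rw [← h3]; simp
  trans := by
    rintro H₁ H₂ H₃ ⟨ψ, h1, h2, h3⟩ ⟨χ, k1, k2, k3⟩
    refine ⟨χ * ψ, ?_, ?_, ?_⟩
    · rw [← k1, ← h1]; group
    · rw [← k2, ← h2]; group
    · rw [← k3, ← h3]; simp

/-- The rooted `(p, q)`-hypermaps with set of darts `D`, up to isomorphism of rooted hypermaps. -/
def rootedSetoid (D : Type*) (p q : ℕ) :
    Setoid {H : RootedHypermap D // H.toHypermap.IsPQ p q} where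
  r H₁ H₂ := RootedHypermap.Iso H₁.1 H₂.1
  iseqv :=
    ⟨fun H => RootedHypermap.Iso.equivalence.refl H.1,
      fun h => RootedHypermap.Iso.equivalence.symm h,
      fun h k => RootedHypermap.Iso.equivalence.trans h k⟩

/-- The number of connected oriented rooted `(p, q)`-hypermaps on `n` darts
(up to isomorphism of rooted hypermaps). -/
def numRooted (p q n : ℕ) : ℕ :=
  Nat.card (Quotient (rootedSetoid (Fin n) p q))

/-- The generating series `H°(z) = ∑ₙ (numRooted p q n) zⁿ`, as a formal power series over `R`. -/
def Hcirc (R : Type*) [Semiring R] (p q : ℕ) : PowerSeries R :=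
  PowerSeries.mk fun n => (numRooted p q n : R)

/-- The formal generalized hypergeometric series with upper parameters `a` and lower
parameters `b`: its `k`-th coefficient is `∏ (a)ₖ / (∏ (b)ₖ · k!)`, where `(a)ₖ` is the
Pochhammer symbol `a (a + 1) ⋯ (a + k - 1)`. -/
def hypergeometricSeries (a b : Multiset ℝ) : PowerSeries ℝ :=
  PowerSeries.mk fun k =>
    (a.map fun x => (ascPochhammer ℝ k).eval x).prod /
      ((b.map fun x => (ascPochhammer ℝ k).eval x).prod * (k.factorial : ℝ))

/-- The indices `1 ≤ i ≤ pq / gcd(p, q) - 1` with `p ∤ i` and `q ∤ i`. -/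
def indices (p q : ℕ) : Finset ℕ :=
  {i ∈ Finset.Icc 1 (p * q / p.gcd q - 1) | ¬ p ∣ i ∧ ¬ q ∣ i}

/-- The parameter `aᵢ = i gcd(p, q) / (p q)`. -/
def param (p q i : ℕ) : ℝ :=
  (i : ℝ) * (p.gcd q : ℝ) / ((p : ℝ) * (q : ℝ))

/-- The number `N` of the parameters `aᵢ`. -/
def numParams (p q : ℕ) : ℕ := (indices p q).card

/-- The hypergeometric series `f = _N F_0` with upper parameters `aᵢ` and no lower ones. -/
def fSeries (p q : ℕ) : PowerSeries ℝ :=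
  hypergeometricSeries ((indices p q).val.map (param p q)) 0

/-- The positive real number `c` with `c ^ gcd(p, q) = lcm(p, q) ^ ((p - 1) (q - 1) - 1)`. -/
def cConst (p q : ℕ) : ℝ :=
  (p.lcm q : ℝ) ^ ((((p : ℝ) - 1) * ((q : ℝ) - 1) - 1) / (p.gcd q : ℝ))

/-- `C = (2π)^((N - 1) / 2) lcm(p, q) / ∏ Γ(aᵢ)`. -/
def asympC (p q : ℕ) : ℝ :=
  (2 * Real.pi) ^ (((numParams p q : ℝ) - 1) / 2) * (p.lcm q : ℝ) /
    ∏ i ∈ indices p q, Real.Gamma (param p q i)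

/-- `c₀ = (N - 1) / 2 - ∑ aᵢ`. -/
def asympC₀ (p q : ℕ) : ℝ :=
  ((numParams p q : ℝ) - 1) / 2 - ∑ i ∈ indices p q, param p q i

/-- `c₁ = 1 + log c - N`. -/
def asympC₁ (p q : ℕ) : ℝ :=
  1 + Real.log (cConst p q) - (numParams p q : ℝ)

end PQHypermap

end

namespace PQHypermap

/-! ### Permutations all of whose cycles have the same length -/

section

open Equiv

/-! A rooted hypermap is the same as a root together with `α` and `φ`, where `α` and `φ` are
independent choices except for transitivity. Without transitivity, pairs on `n` points are counted
by cycle type (`numUniform_mul`). Cutting a pointed pair along the orbit of its point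
(`card_pairs_mul_card`), and using that rooted hypermaps have no nontrivial automorphism
(`numRooted_mul_factorial`), gives `H° F = z F'`, where `F` is the exponential generating series of
all pairs. With `L = lcm(p, q)`, inclusion-exclusion over the multiples of `p` and `q` simplifies
the ratio of successive non-zero coefficients of `F` to that of `f(c z^L)` (`pairDensity_succ`).
Hence `F(z) = f(c z^L)`, and `H°` is its logarithmic derivative times `z`.

Everything else is growth. Let `A_k` and `h_k` be the coefficients of `f` and `x f'/f`. Since `pq ≥
6` forces `N ≥ 2`, the ratios `A_{k+1}/A_k` are nondecreasing and at least linear in `k`, so `f` has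
radius 0. As `h_k ≥ 0` by its counting meaning, monotone ratios give `A_k ≤ h_k ≤ k A_k` for `k ≥
1`, hence nonvanishing. The convolution of `A` with itself is negligible apart from its two extreme
terms with index 0, so `h_k ~ k A_k`; Euler's limit for Gamma and Stirling's formula then give the
asymptotics. Finally, an algebraic power series converges near 0
(`IsAlgebraic.exists_truncNorm_le`), whereas `h_k ≥ A_k` prevents this for `H°`. -/

theorem isPeriodicPt_perm_iff {D : Type*} (π : Perm D) (n : ℕ) (x : D) :
    Function.IsPeriodicPt π n x ↔ (π ^ n) x = x := by
  rw [Function.IsPeriodicPt, Function.IsFixedPt, Perm.iterate_eq_pow]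

theorem minimalPeriod_eq_card_support_cycleOf {D : Type*} [Fintype D] [DecidableEq D]
    (π : Perm D) {x : D} (hx : π x ≠ x) :
    Function.minimalPeriod π x = (π.cycleOf x).support.card := by
  have hc : (π.cycleOf x).IsCycle := Perm.isCycle_cycleOf π hx
  rw [← hc.orderOf]
  apply Nat.dvd_antisymm
  · rw [← Function.isPeriodicPt_iff_minimalPeriod_dvd, isPeriodicPt_perm_iff,
      ← Perm.cycleOf_pow_apply_self, pow_orderOf_eq_one, Perm.one_apply]
  · rw [orderOf_dvd_iff_pow_eq_one, hc.pow_eq_one_iff]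
    refine ⟨x, by rwa [Perm.cycleOf_apply_self], ?_⟩
    rw [Perm.cycleOf_pow_apply_self, ← isPeriodicPt_perm_iff]
    exact Function.isPeriodicPt_minimalPeriod _ _

theorem allCyclesOfLength_iff_cycleType {D : Type*} [Fintype D] [DecidableEq D]
    (π : Perm D) {l : ℕ} (hl : 2 ≤ l) :
    AllCyclesOfLength π l ↔
      l ∣ Fintype.card D ∧ π.cycleType = Multiset.replicate (Fintype.card D / l) l := by
  have hcyc : ∀ x, π x ≠ x → π.cycleOf x ∈ π.cycleFactorsFinset := fun x hx =>
    Perm.cycleOf_mem_cycleFactorsFinset_iff.2 (Perm.mem_support.2 hx)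
  constructor
  · intro h
    have hne : ∀ x, π x ≠ x := fun x hx => by
      have h1 := h x
      rw [Function.minimalPeriod_eq_one_iff_isFixedPt.2 hx] at h1
      omega
    have hrep : π.cycleType = Multiset.replicate (Multiset.card π.cycleType) l := by
      rw [Multiset.eq_replicate]
      refine ⟨rfl, fun b hb => ?_⟩
      rw [Perm.cycleType_def, Multiset.mem_map] at hb
      obtain ⟨c, hc, rfl⟩ := hb
      obtain ⟨x, hx⟩ := (Perm.mem_cycleFactorsFinset_iff.1 hc).1.nonempty_support
      rw [Perm.cycle_is_cycleOf hx hc, Function.comp_apply,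
        ← minimalPeriod_eq_card_support_cycleOf π (hne x), h x]
    have hs := Perm.sum_cycleType π
    rw [show π.support = Finset.univ by ext x; simp [hne x], Finset.card_univ, hrep,
      Multiset.sum_replicate, smul_eq_mul] at hs
    refine ⟨⟨_, by rw [← hs, mul_comm]⟩, ?_⟩
    rw [← hs, Nat.mul_div_cancel _ (by omega)]
    exact hrep
  · rintro ⟨⟨m, hm⟩, h⟩ x
    have hs := Perm.sum_cycleType π
    rw [h, Multiset.sum_replicate, smul_eq_mul, hm, Nat.mul_div_cancel_left _ (by omega),
      mul_comm, ← hm, eq_comm, Finset.card_eq_iff_eq_univ] at hs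
    have hx : π x ≠ x := Perm.mem_support.1 (hs ▸ Finset.mem_univ x)
    rw [minimalPeriod_eq_card_support_cycleOf π hx]
    refine Multiset.eq_of_mem_replicate (n := Fintype.card D / l) ?_
    rw [← h, Perm.cycleType_def]
    exact Multiset.mem_map_of_mem (Finset.card ∘ Perm.support) (hcyc x hx)

/-- The number of permutations of `n` points all of whose cycles have length `l`. -/
noncomputable def numUniform (l n : ℕ) : ℕ :=
  Nat.card {π : Perm (Fin n) // AllCyclesOfLength π l}

theorem numUniform_of_not_dvd {l n : ℕ} (hl : 2 ≤ l) (h : ¬ l ∣ n) : numUniform l n = 0 := by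
  rw [numUniform, Nat.card_eq_zero]
  refine Or.inl ⟨fun π => h ?_⟩
  simpa using ((allCyclesOfLength_iff_cycleType π.1 hl).1 π.2).1

theorem numUniform_mul {l : ℕ} (hl : 2 ≤ l) (m : ℕ) :
    numUniform l (l * m) * (l ^ m * m.factorial) = (l * m).factorial := by
  classical
  have h := Perm.card_of_cycleType_mul_eq (Fin (l * m)) (Multiset.replicate m l)
  have hsum : (Multiset.replicate m l).sum = l * m := by simp [mul_comm]
  rw [hsum, Fintype.card_fin, Nat.sub_self, Multiset.prod_replicate, Nat.factorial_zero, one_mul,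
    if_pos ⟨le_rfl, fun a ha => by rwa [Multiset.eq_of_mem_replicate ha]⟩] at h
  have hprod : ∏ n ∈ (Multiset.replicate m l).toFinset,
      ((Multiset.replicate m l).count n).factorial = m.factorial := by
    rcases Nat.eq_zero_or_pos m with rfl | hm
    · simp
    · rw [Multiset.toFinset_replicate, if_neg hm.ne', Finset.prod_singleton,
        Multiset.count_replicate_self]
  rw [hprod] at h
  rw [← h, numUniform, Nat.card_eq_fintype_card, Fintype.card_subtype]
  congr 2
  ext π
  simp only [Finset.mem_filter, Finset.mem_univ, true_and,
    allCyclesOfLength_iff_cycleType π hl, Fintype.card_fin, Nat.dvd_mul_right,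
    Nat.mul_div_cancel_left m (show 0 < l by omega)]

/-! ### Cutting a pointed pair of permutations along an orbit -/

/-- A set of points is invariant under two permutations. -/
def Invariant {D : Type*} (a : Perm D × Perm D) (S : Set D) : Prop :=
  ∀ x, (a.1 x ∈ S ↔ x ∈ S) ∧ (a.2 x ∈ S ↔ x ∈ S)

/-- The pairs of permutations whose cycles have lengths `p` and `q`. -/
def Pairs (D : Type*) (p q : ℕ) : Type _ :=
  {a : Perm D × Perm D // AllCyclesOfLength a.1 p ∧ AllCyclesOfLength a.2 q}

/-- The rooted pairs of permutations with cycle lengths `p`, `q` which generate a transitive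
group. -/
def RootedPairs (D : Type*) (p q : ℕ) : Type _ :=
  {a : (Perm D × Perm D) × D // (AllCyclesOfLength a.1.1 p ∧ AllCyclesOfLength a.1.2 q) ∧
    ∀ S, Invariant a.1 S → a.2 ∈ S → S = Set.univ}

instance {D : Type*} [Finite D] (p q : ℕ) : Finite (Pairs D p q) :=
  Subtype.finite

instance {D : Type*} [Finite D] (p q : ℕ) : Finite (RootedPairs D p q) :=
  Subtype.finite

/-- The orbit of a point under two permutations, as the least invariant set. -/
def hull {D : Type*} (a : Perm D × Perm D) (x : D) : Set D :=
  ⋂₀ {S | Invariant a S ∧ x ∈ S}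

theorem mem_hull_self {D : Type*} (a : Perm D × Perm D) (x : D) : x ∈ hull a x :=
  Set.mem_sInter.2 fun _ hS => hS.2

theorem invariant_hull {D : Type*} (a : Perm D × Perm D) (x : D) : Invariant a (hull a x) := by
  intro y
  simp only [hull, Set.mem_sInter, Set.mem_ofPred_eq]
  exact ⟨forall₂_congr fun S hS => (hS.1 y).1, forall₂_congr fun S hS => (hS.1 y).2⟩

theorem hull_subset {D : Type*} {a : Perm D × Perm D} {x : D} {S : Set D} (hS : Invariant a S)
    (hx : x ∈ S) : hull a x ⊆ S :=
  Set.sInter_subset_of_mem ⟨hS, hx⟩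

/-- Gluing permutations of a set and of its complement. -/
def glue {D : Type*} (S : Set D) [DecidablePred (· ∈ S)]
    (a : Perm {x // x ∈ S} × Perm {x // x ∈ S}) (b : Perm {x // ¬ x ∈ S} × Perm {x // ¬ x ∈ S}) :
    Perm D × Perm D :=
  (Perm.subtypeCongr a.1 b.1, Perm.subtypeCongr a.2 b.2)

theorem subtypeCongr_mem_iff {D : Type*} (S : Set D) [DecidablePred (· ∈ S)]
    (a : Perm {x // x ∈ S}) (b : Perm {x // ¬ x ∈ S}) (x : D) :
    Perm.subtypeCongr a b x ∈ S ↔ x ∈ S := by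
  by_cases h : x ∈ S
  · simp [Perm.subtypeCongr.left_apply _ _ h, h]
  · rw [Perm.subtypeCongr.right_apply _ _ h]
    simpa [h] using (b ⟨x, h⟩).2

theorem invariant_glue {D : Type*} (S : Set D) [DecidablePred (· ∈ S)]
    (a : Perm {x // x ∈ S} × Perm {x // x ∈ S})
    (b : Perm {x // ¬ x ∈ S} × Perm {x // ¬ x ∈ S}) : Invariant (glue S a b) S :=
  fun x => ⟨subtypeCongr_mem_iff S _ _ x, subtypeCongr_mem_iff S _ _ x⟩

theorem minimalPeriod_of_semiconj_injective {D E : Type*} {f : D → D} {g : E → E} {i : E → D}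
    (hi : Function.Injective i) (h : Function.Semiconj i g f) (x : E) :
    Function.minimalPeriod f (i x) = Function.minimalPeriod g x := by
  rw [Function.minimalPeriod_eq_minimalPeriod_iff]
  intro n
  rw [Function.IsPeriodicPt, Function.IsPeriodicPt, Function.IsFixedPt, Function.IsFixedPt,
    ← (h.iterate_right n).eq, hi.eq_iff]

theorem allCyclesOfLength_subtypeCongr_iff {D : Type*} (S : Set D) [DecidablePred (· ∈ S)]
    (a : Perm {x // x ∈ S}) (b : Perm {x // ¬ x ∈ S}) (l : ℕ) :
    AllCyclesOfLength (Perm.subtypeCongr a b) l ↔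
      AllCyclesOfLength a l ∧ AllCyclesOfLength b l := by
  have ha : ∀ x : {x // x ∈ S}, Function.minimalPeriod (Perm.subtypeCongr a b) (x : D) =
      Function.minimalPeriod a x :=
    minimalPeriod_of_semiconj_injective Subtype.val_injective fun x => by
      rw [Perm.subtypeCongr.left_apply_subtype]
  have hb : ∀ x : {x // ¬ x ∈ S}, Function.minimalPeriod (Perm.subtypeCongr a b) (x : D) =
      Function.minimalPeriod b x :=
    minimalPeriod_of_semiconj_injective Subtype.val_injective fun x => by
      rw [Perm.subtypeCongr.right_apply_subtype]
  constructor
  · exact fun h => ⟨fun x => by rw [← ha, h x], fun x => by rw [← hb, h x]⟩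
  · rintro ⟨h, k⟩ x
    by_cases hx : x ∈ S
    · rw [← h ⟨x, hx⟩, ← ha]
    · rw [← k ⟨x, hx⟩, ← hb]

/-- An invariant set of the `S`-part stays invariant in `D`, and an invariant set of `D` restricts
to `S`. This is what lets the splitting recover `S` as the orbit of the marked point. -/
theorem hull_glue {D : Type*} (S : Set D) [DecidablePred (· ∈ S)]
    (a : Perm {x // x ∈ S} × Perm {x // x ∈ S})
    (b : Perm {x // ¬ x ∈ S} × Perm {x // ¬ x ∈ S}) (x : {x // x ∈ S}) :
    hull (glue S a b) x = S ↔ ∀ T, Invariant a T → x ∈ T → T = Set.univ := by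
  have hval : ∀ y : {x // x ∈ S}, (glue S a b).1 y = a.1 y ∧ (glue S a b).2 y = a.2 y :=
    fun y => ⟨Perm.subtypeCongr.left_apply_subtype _ _ y,
      Perm.subtypeCongr.left_apply_subtype _ _ y⟩
  constructor
  · intro h T hT hx
    have hinv : Invariant (glue S a b) (Subtype.val '' T) := by
      intro y
      by_cases hy : y ∈ S
      · have h1 := hval ⟨y, hy⟩
        have h2 := hT ⟨y, hy⟩
        simp only at h1
        rw [h1.1, h1.2]
        simp only [Subtype.val_injective.mem_set_image]
        rw [h2.1, h2.2]
        simp [hy]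
      · have h1 : ∀ z, z ∉ S → z ∉ Subtype.val '' T := by
          rintro z hz ⟨w, -, rfl⟩
          exact hz w.2
        have h2 := invariant_glue S a b y
        simp [h1 y hy, h1 _ (mt h2.1.1 hy), h1 _ (mt h2.2.1 hy)]
    have hsub := hull_subset hinv ⟨x, hx, rfl⟩
    rw [h] at hsub
    ext y
    obtain ⟨z, hz, hzy⟩ := hsub y.2
    simpa [Subtype.val_injective hzy] using hz
  · intro h
    apply subset_antisymm (hull_subset (invariant_glue S a b) x.2)
    have h1 := h (Subtype.val ⁻¹' hull (glue S a b) x) (fun y => by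
      have h2 := invariant_hull (glue S a b) (x : D) y
      rwa [(hval y).1, (hval y).2] at h2) (mem_hull_self _ _)
    intro y hy
    exact (Set.ext_iff.1 h1 ⟨y, hy⟩).2 trivial

open Classical in
/-- Splitting a pointed pair of permutations along the orbit of the point. -/
theorem card_pairs_mul_card {D : Type*} [Fintype D] (p q : ℕ) :
    Nat.card (Pairs D p q) * Fintype.card D =
      ∑ S : Set D, Nat.card (RootedPairs {x // x ∈ S} p q) *
        Nat.card (Pairs {x // ¬ x ∈ S} p q) := by
  rw [← Nat.card_eq_fintype_card, ← Nat.card_prod]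
  simp_rw [← Nat.card_prod]
  rw [← Nat.card_sigma]
  symm
  let F : (Σ S : Set D, RootedPairs {x // x ∈ S} p q × Pairs {x // ¬ x ∈ S} p q) →
      Pairs D p q × D := fun s =>
    (⟨glue s.1 s.2.1.1.1 s.2.2.1,
      (allCyclesOfLength_subtypeCongr_iff _ _ _ _).2 ⟨s.2.1.2.1.1, s.2.2.2.1⟩,
      (allCyclesOfLength_subtypeCongr_iff _ _ _ _).2 ⟨s.2.1.2.1.2, s.2.2.2.2⟩⟩, s.2.1.1.2)
  refine Nat.card_eq_of_bijective F ⟨?_, ?_⟩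
  · rintro ⟨S, ⟨⟨a, x⟩, ha⟩, ⟨b, hb⟩⟩ ⟨S', ⟨⟨a', x'⟩, ha'⟩, ⟨b', hb'⟩⟩ h
    have h1 : glue S a b = glue S' a' b' := congrArg (fun s => s.1.1) h
    have h2 : (x : D) = x' := congrArg Prod.snd h
    -- Both `S` and `S'` are the orbit of the same point under the same pair.
    have e1 := (hull_glue S a b x).2 ha.2
    have e2 := (hull_glue S' a' b' x').2 ha'.2
    rw [← h1, ← h2, e1] at e2
    subst e2
    have i1 := Perm.subtypeCongrHom_injective (· ∈ S) (a₁ := (a.1, b.1)) (a₂ := (a'.1, b'.1))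
      (congrArg Prod.fst h1)
    have i2 := Perm.subtypeCongrHom_injective (· ∈ S) (a₁ := (a.2, b.2)) (a₂ := (a'.2, b'.2))
      (congrArg Prod.snd h1)
    simp only [Prod.mk.injEq] at i1 i2
    obtain rfl : a = a' := Prod.ext i1.1 i2.1
    obtain rfl : b = b' := Prod.ext i1.2 i2.2
    obtain rfl : x = x' := Subtype.ext h2
    rfl
  · rintro ⟨⟨c, hc⟩, x⟩
    set S := hull c x with hS
    have hinv : Invariant c S := invariant_hull c x
    have hg : ∀ (π : Perm D) (h : ∀ y, π y ∈ S ↔ y ∈ S),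
        Perm.subtypeCongr (π.subtypePerm (p := (· ∈ S)) h)
          (π.subtypePerm (p := fun y => ¬ y ∈ S) fun y => not_congr (h y)) = π := by
      intro π h
      ext y
      by_cases hy : y ∈ S
      · rw [Perm.subtypeCongr.left_apply _ _ hy]; rfl
      · rw [Perm.subtypeCongr.right_apply _ _ hy]; rfl
    let a : Perm {x // x ∈ S} × Perm {x // x ∈ S} :=
      (c.1.subtypePerm fun y => (hinv y).1, c.2.subtypePerm fun y => (hinv y).2)
    let b : Perm {x // ¬ x ∈ S} × Perm {x // ¬ x ∈ S} :=
      (c.1.subtypePerm fun y => not_congr (hinv y).1,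
        c.2.subtypePerm fun y => not_congr (hinv y).2)
    have hab : glue S a b = c := Prod.ext (hg c.1 fun y => (hinv y).1) (hg c.2 fun y => (hinv y).2)
    have hc' : AllCyclesOfLength (glue S a b).1 p ∧ AllCyclesOfLength (glue S a b).2 q := by
      rwa [hab]
    rw [glue, allCyclesOfLength_subtypeCongr_iff, allCyclesOfLength_subtypeCongr_iff] at hc'
    refine ⟨⟨S, ⟨⟨a, ⟨x, mem_hull_self c x⟩⟩, ⟨hc'.1.1, hc'.2.1⟩, ?_⟩,
      ⟨b, hc'.1.2, hc'.2.2⟩⟩, ?_⟩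
    · refine (hull_glue S a b _).1 ?_
      rw [hab]
    · exact Prod.ext (Subtype.ext hab) rfl

/-- Transport of permutations along a bijection preserves the lengths of the cycles. -/
theorem allCyclesOfLength_permCongr_iff {D E : Type*} (e : D ≃ E) (π : Perm D) (l : ℕ) :
    AllCyclesOfLength (e.permCongr π) l ↔ AllCyclesOfLength π l := by
  have h : ∀ x, Function.minimalPeriod (e.permCongr π) (e x) = Function.minimalPeriod π x :=
    minimalPeriod_of_semiconj_injective e.injective fun x => by simp
  exact ⟨fun k x => by rw [← h, k], fun k x => by rw [← e.apply_symm_apply x, h, k]⟩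

theorem invariant_permCongr_iff {D E : Type*} (e : D ≃ E) (a : Perm D × Perm D) (S : Set E) :
    Invariant (e.permCongr a.1, e.permCongr a.2) S ↔ Invariant a (e ⁻¹' S) := by
  refine e.symm.forall_congr fun {x} => ?_
  simp [Equiv.permCongr_apply]

theorem card_pairs_congr {D E : Type*} (e : D ≃ E) (p q : ℕ) :
    Nat.card (Pairs D p q) = Nat.card (Pairs E p q) :=
  Nat.card_congr ((e.permCongr.prodCongr e.permCongr).subtypeEquiv fun a => by
    simp [allCyclesOfLength_permCongr_iff])

/-- Transport of rooted pairs of permutations along a bijection. -/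
def RootedPairs.congr {D E : Type*} (e : D ≃ E) (p q : ℕ) :
    RootedPairs D p q ≃ RootedPairs E p q := by
  refine ((e.permCongr.prodCongr e.permCongr).prodCongr e).subtypeEquiv fun a => ?_
  simp only [Equiv.prodCongr_apply, Prod.map_fst, Prod.map_snd, allCyclesOfLength_permCongr_iff]
  refine and_congr Iff.rfl ⟨fun h S hS hx => ?_, fun h S hS hx => ?_⟩
  · have := h (e ⁻¹' S) ((invariant_permCongr_iff e a.1 S).1 hS) hx
    rwa [Set.preimage_eq_univ_iff, e.surjective.range_eq, Set.univ_subset_iff] at this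
  · have := h (e '' S) ((invariant_permCongr_iff e a.1 (e '' S)).2 (by
      rwa [e.injective.preimage_image])) (Set.mem_image_of_mem e hx)
    rw [← e.injective.preimage_image S, this, Set.preimage_univ]

theorem card_rootedPairs_congr {D E : Type*} (e : D ≃ E) (p q : ℕ) :
    Nat.card (RootedPairs D p q) = Nat.card (RootedPairs E p q) :=
  Nat.card_congr (RootedPairs.congr e p q)

theorem card_pairs_fin (p q n : ℕ) :
    Nat.card (Pairs (Fin n) p q) = numUniform p n * numUniform q n := by
  rw [numUniform, numUniform, ← Nat.card_prod]
  exact Nat.card_congr (Equiv.subtypeProdEquivProd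
    (p := fun π : Perm (Fin n) => AllCyclesOfLength π p)
    (q := fun π : Perm (Fin n) => AllCyclesOfLength π q))

open Classical in
-- The summand of `card_pairs_mul_card` depends only on the size `m` of the orbit, so the subsets
-- are grouped by size.
theorem card_pairs_fin_mul (p q n : ℕ) :
    Nat.card (Pairs (Fin n) p q) * n =
      ∑ m ∈ Finset.range (n + 1), n.choose m *
        (Nat.card (RootedPairs (Fin m) p q) * Nat.card (Pairs (Fin (n - m)) p q)) := by
  have h := card_pairs_mul_card (D := Fin n) p q
  rw [Fintype.card_fin] at h
  rw [h]
  have h2 : ∀ S : Set (Fin n), Nat.card (RootedPairs {x // x ∈ S} p q) *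
        Nat.card (Pairs {x // ¬ x ∈ S} p q) =
      Nat.card (RootedPairs (Fin S.ncard) p q) * Nat.card (Pairs (Fin (n - S.ncard)) p q) := by
    intro S
    have e1 : Fintype.card {x // x ∈ S} = S.ncard := by
      rw [← Nat.card_eq_fintype_card]; rfl
    have e2 : Fintype.card {x // ¬ x ∈ S} = n - S.ncard := by
      rw [Fintype.card_subtype_compl, Fintype.card_fin, ← e1]
    rw [card_rootedPairs_congr (Fintype.equivFinOfCardEq e1),
      card_pairs_congr (Fintype.equivFinOfCardEq e2)]
  rw [Finset.sum_congr rfl fun S _ => h2 S, ← Fintype.finsetEquivSet.sum_comp]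
  simp only [Fintype.coe_finsetEquivSet, Set.ncard_coe_finset]
  rw [← Finset.powerset_univ, Finset.sum_powerset_apply_card (fun m =>
    Nat.card (RootedPairs (Fin m) p q) * Nat.card (Pairs (Fin (n - m)) p q)), Finset.card_univ,
    Fintype.card_fin]
  simp

end

/-! ### Rooted hypermaps as rooted pairs, and their labellings -/

section

open Equiv

/-- `α, φ` and `α, σ` generate the same group, so transitivity may be tested on either pair. -/
theorem invariant_inv_mul_inv_iff {D : Type*} (α σ : Perm D) (S : Set D) :
    Invariant (α, α⁻¹ * σ⁻¹) S ↔ Invariant (α, σ) S := by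
  have hα : ∀ y, α (α⁻¹ y) = y := fun y => α.apply_symm_apply y
  have hσ : ∀ y, σ (σ⁻¹ y) = y := fun y => σ.apply_symm_apply y
  have hσ' : ∀ y, σ⁻¹ (σ y) = y := fun y => σ.symm_apply_apply y
  constructor
  · intro h
    refine fun x => ⟨(h x).1, ?_⟩
    have h1 : α (α⁻¹ x) ∈ S ↔ α⁻¹ x ∈ S := (h (α⁻¹ x)).1
    have h2 : α⁻¹ (σ⁻¹ (σ x)) ∈ S ↔ σ x ∈ S := (h (σ x)).2
    rw [hα] at h1
    rw [hσ'] at h2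
    rw [h1, h2]
  · intro h
    refine fun x => ⟨(h x).1, ?_⟩
    have h1 : α (α⁻¹ (σ⁻¹ x)) ∈ S ↔ α⁻¹ (σ⁻¹ x) ∈ S := (h (α⁻¹ (σ⁻¹ x))).1
    have h2 : σ (σ⁻¹ x) ∈ S ↔ σ⁻¹ x ∈ S := (h (σ⁻¹ x)).2
    rw [hα] at h1
    rw [hσ] at h2
    change α⁻¹ (σ⁻¹ x) ∈ S ↔ x ∈ S
    rw [← h1, h2]

theorem isPretransitive_closure_iff {D : Type*} (α σ : Perm D) (x : D) :
    MulAction.IsPretransitive (Subgroup.closure {α, σ}) D ↔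
      ∀ S, Invariant (α, σ) S → x ∈ S → S = Set.univ := by
  constructor
  · intro h S hS hx
    have key : ∀ g ∈ Subgroup.closure {α, σ}, ∀ z, g z ∈ S ↔ z ∈ S := by
      intro g hg
      induction hg using Subgroup.closure_induction with
      | mem g hg =>
        rcases hg with rfl | rfl
        · exact fun z => (hS z).1
        · exact fun z => (hS z).2
      | one => simp
      | mul g k _ _ hg hk => exact fun z => by rw [Perm.mul_apply, hg, hk]
      | inv g _ hg =>
        intro z
        rw [← hg, show g (g⁻¹ z) = z from g.apply_symm_apply z]
    ext y
    obtain ⟨g, rfl⟩ := h.exists_smul_eq x y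
    exact iff_of_true ((key g.1 g.2 x).2 hx) trivial
  · intro h
    have hα : α ∈ Subgroup.closure {α, σ} := Subgroup.subset_closure (by simp)
    have hσ : σ ∈ Subgroup.closure {α, σ} := Subgroup.subset_closure (by simp)
    have hmem : ∀ (g : Subgroup.closure {α, σ}) (y : D),
        g • y ∈ MulAction.orbit (Subgroup.closure {α, σ}) x ↔
          y ∈ MulAction.orbit (Subgroup.closure {α, σ}) x := fun g y => by
      rw [← MulAction.orbit_eq_iff, MulAction.orbit_smul, MulAction.orbit_eq_iff]
    exact (MulAction.isPretransitive_iff_orbit_eq_univ x).2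
      (h _ (fun y => ⟨hmem ⟨α, hα⟩ y, hmem ⟨σ, hσ⟩ y⟩) (MulAction.mem_orbit_self x))

/-- A rooted hypermap is determined by its root and the permutations `α` and `φ`. -/
def rootedPairsEquiv (D : Type*) (p q : ℕ) :
    {H : RootedHypermap D // H.toHypermap.IsPQ p q} ≃ RootedPairs D p q where
  toFun H := ⟨((H.1.α, H.1.φ), H.1.root), H.2, fun S hS =>
    (isPretransitive_closure_iff _ _ H.1.root).1 H.1.transitive S
      ((invariant_inv_mul_inv_iff _ _ S).1 hS)⟩
  invFun a := ⟨⟨⟨a.1.1.1, a.1.1.2⁻¹ * a.1.1.1⁻¹, (isPretransitive_closure_iff _ _ a.1.2).2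
      fun S hS => a.2.2 S (by
        rw [← invariant_inv_mul_inv_iff] at hS
        simpa using hS)⟩, a.1.2⟩, a.2.1.1, by
      simpa [Hypermap.φ] using a.2.1.2⟩
  left_inv H := by
    rcases H with ⟨⟨⟨α, σ, h⟩, x⟩, hH⟩
    simp [Hypermap.φ]
  right_inv a := by
    rcases a with ⟨⟨⟨α, φ⟩, x⟩, ha⟩
    exact Subtype.ext (by simp [Hypermap.φ])

/-- The fixed points of an automorphism form an invariant set containing the root, hence are all
points. -/
theorem rootedPairs_rigid {D : Type*} {p q : ℕ} (a : RootedPairs D p q) (χ : Perm D)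
    (h : RootedPairs.congr χ p q a = a) : χ = 1 := by
  have h' := congrArg Subtype.val h
  have h1 : χ.permCongr a.1.1.1 = a.1.1.1 := congrArg (fun b => b.1.1) h'
  have h2 : χ.permCongr a.1.1.2 = a.1.1.2 := congrArg (fun b => b.1.2) h'
  have h3 : χ a.1.2 = a.1.2 := congrArg (fun b => b.2) h'
  have hcomm : ∀ π : Perm D, χ.permCongr π = π → ∀ x, χ (π x) = π x ↔ χ x = x := by
    intro π hπ x
    have : χ (π x) = π (χ x) := by
      conv_rhs => rw [← hπ]
      simp
    rw [this, π.injective.eq_iff]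
  have := a.2.2 {x | χ x = x} (fun x => ⟨hcomm _ h1 x, hcomm _ h2 x⟩) h3
  ext x
  exact (Set.ext_iff.1 this x).2 trivial

theorem iso_iff_congr {D : Type*} {p q : ℕ}
    (H K : {H : RootedHypermap D // H.toHypermap.IsPQ p q}) :
    RootedHypermap.Iso H.1 K.1 ↔
      ∃ ψ : Perm D, RootedPairs.congr ψ p q (rootedPairsEquiv D p q H) =
        rootedPairsEquiv D p q K := by
  have hconj : ∀ ψ π : Perm D, ψ.permCongr π = ψ * π * ψ⁻¹ := fun ψ π => rfl
  refine exists_congr fun ψ => ⟨?_, fun h => ?_⟩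
  · rintro ⟨h1, h2, h3⟩
    refine Subtype.ext (Prod.ext (Prod.ext h1 ?_) h3)
    change ψ * H.1.φ * ψ⁻¹ = K.1.φ
    rw [Hypermap.φ, Hypermap.φ, ← h1, ← h2]
    group
  · have h' := congrArg Subtype.val h
    have h1 : ψ * H.1.α * ψ⁻¹ = K.1.α := congrArg (fun b => b.1.1) h'
    have h2 : ψ * H.1.φ * ψ⁻¹ = K.1.φ := congrArg (fun b => b.1.2) h'
    have h3 : ψ H.1.root = K.1.root := congrArg (fun b => b.2) h'
    refine ⟨h1, ?_, h3⟩
    have e : ∀ G : Hypermap D, G.σ = G.φ⁻¹ * G.α⁻¹ := fun G => by simp [Hypermap.φ]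
    rw [e, e K.1.toHypermap, ← h1, ← h2]
    group

theorem congr_mul {D : Type*} {p q : ℕ} (χ ψ : Perm D) (a : RootedPairs D p q) :
    RootedPairs.congr (χ * ψ) p q a =
      RootedPairs.congr χ p q (RootedPairs.congr ψ p q a) := rfl

theorem congr_one {D : Type*} {p q : ℕ} (a : RootedPairs D p q) :
    RootedPairs.congr (1 : Perm D) p q a = a := rfl

/-- Every rooted hypermap on `n` darts has `n!` different labellings. -/
theorem numRooted_mul_factorial (p q n : ℕ) :
    numRooted p q n * n.factorial = Nat.card (RootedPairs (Fin n) p q) := by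
  have hperm : n.factorial = Nat.card (Perm (Fin n)) := by
    rw [Nat.card_perm, Nat.card_eq_fintype_card, Fintype.card_fin]
  rw [numRooted, hperm, ← Nat.card_prod]
  -- A representative of each class is relabelled in all `n!` ways; rigidity makes these labellings
  -- distinct.
  let F : Quotient (rootedSetoid (Fin n) p q) × Perm (Fin n) → RootedPairs (Fin n) p q :=
    fun s => RootedPairs.congr s.2 p q (rootedPairsEquiv _ p q s.1.out)
  refine Nat.card_eq_of_bijective F ⟨?_, fun a => ?_⟩
  · rintro ⟨Q, ψ⟩ ⟨Q', ψ'⟩ h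
    change RootedPairs.congr ψ p q (rootedPairsEquiv _ p q Q.out) =
      RootedPairs.congr ψ' p q (rootedPairsEquiv _ p q Q'.out) at h
    have h1 : RootedPairs.congr (ψ'⁻¹ * ψ) p q (rootedPairsEquiv _ p q Q.out) =
        rootedPairsEquiv _ p q Q'.out := by
      rw [congr_mul, h, ← congr_mul, inv_mul_cancel, congr_one]
    obtain rfl : Q = Q' := by
      rw [← Q.out_eq, ← Q'.out_eq]
      exact Quotient.sound ((iso_iff_congr Q.out Q'.out).2 ⟨_, h1⟩)
    rw [Prod.mk.injEq]
    exact ⟨rfl, (inv_mul_eq_one.1 (rootedPairs_rigid _ _ h1)).symm⟩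
  · obtain ⟨H, rfl⟩ := (rootedPairsEquiv _ p q).surjective a
    have h : (rootedSetoid (Fin n) p q).r (Quotient.mk (rootedSetoid (Fin n) p q) H).out H :=
      Quotient.exact (Quotient.out_eq _)
    obtain ⟨ψ, hψ⟩ := (iso_iff_congr _ _).1 h
    exact ⟨⟨_, ψ⟩, hψ⟩

/-- The number of labelled pairs with `n` points, divided by `n!`. -/
noncomputable def pairDensity (p q n : ℕ) : ℝ :=
  (Nat.card (Pairs (Fin n) p q) : ℝ) / (n.factorial : ℝ)

/-- Coefficientwise form of `z F' = H° F`: dividing by `n!` turns the binomial convolution into a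
Cauchy product. -/
theorem pairDensity_mul (p q n : ℕ) :
    (n : ℝ) * pairDensity p q n = ∑ m ∈ Finset.range (n + 1),
      (numRooted p q m : ℝ) * pairDensity p q (n - m) := by
  have h : ((Nat.card (Pairs (Fin n) p q) * n : ℕ) : ℝ) = _ :=
    congrArg (Nat.cast : ℕ → ℝ) (card_pairs_fin_mul p q n)
  push_cast at h
  have hn : (n.factorial : ℝ) ≠ 0 := by positivity
  rw [pairDensity, mul_div_assoc', mul_comm (n : ℝ), h, Finset.sum_div]
  refine Finset.sum_congr rfl fun m hm => ?_
  have hm' : m ≤ n := Nat.lt_succ_iff.1 (Finset.mem_range.1 hm)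
  rw [← numRooted_mul_factorial, pairDensity, Nat.cast_choose ℝ hm']
  have h1 : (m.factorial : ℝ) ≠ 0 := by positivity
  have h2 : ((n - m).factorial : ℝ) ≠ 0 := by positivity
  push_cast
  field_simp

end

/-! ### Inclusion-exclusion and the constants `N`, `c`, `aᵢ` -/

theorem prod_filter_dvd {M : Type*} [CommMonoid M] (w : ℕ → M) {l : ℕ} (hl : 0 < l) (d : ℕ) :
    ∏ i ∈ Finset.Icc 1 (l * d) with l ∣ i, w i = ∏ j ∈ Finset.range d, w (l * (j + 1)) := by
  symm
  refine Finset.prod_nbij (fun j => l * (j + 1)) ?_ ?_ ?_ fun _ _ => rfl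
  · intro j hj
    rw [Finset.mem_range] at hj
    rw [Finset.mem_filter, Finset.mem_Icc]
    exact ⟨⟨Nat.mul_pos hl j.succ_pos, Nat.mul_le_mul_left l hj⟩, Nat.dvd_mul_right _ _⟩
  · intro i _ j _ h
    have := Nat.eq_of_mul_eq_mul_left hl h
    omega
  · rintro i hi
    simp only [Finset.coe_filter, Finset.mem_Icc, Set.mem_ofPred_eq] at hi
    obtain ⟨⟨h1, h2⟩, ⟨j, rfl⟩⟩ := hi
    have hj : 0 < j := Nat.pos_of_ne_zero fun h => by simp [h] at h1
    refine ⟨j - 1, ?_, ?_⟩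
    · have := Nat.le_of_mul_le_mul_left h2 hl
      simp only [Finset.coe_range, Set.mem_Iio]
      omega
    · simp only
      congr 1
      omega

/-- Inclusion-exclusion for the multiples of `p` and `q` up to `lcm p q`. -/
theorem prod_Icc_lcm {M : Type*} [CommMonoid M] (w : ℕ → M) {p q : ℕ} (hp : 0 < p)
    (hq : 0 < q) :
    (∏ i ∈ Finset.Icc 1 (p.lcm q), w i) * w (p.lcm q) =
      (∏ i ∈ Finset.Icc 1 (p.lcm q) with p ∣ i, w i) *
        (∏ i ∈ Finset.Icc 1 (p.lcm q) with q ∣ i, w i) * ∏ i ∈ indices p q, w i := by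
  have hL : 0 < p.lcm q := Nat.lcm_pos hp hq
  have hI : indices p q = {i ∈ {i ∈ Finset.Icc 1 (p.lcm q) | ¬ p ∣ i} | ¬ q ∣ i} := by
    ext i
    rw [indices, show p * q / p.gcd q = p.lcm q from rfl]
    simp only [Finset.mem_filter, Finset.mem_Icc]
    constructor
    · rintro ⟨⟨h1, h2⟩, h3, h4⟩
      exact ⟨⟨⟨h1, by omega⟩, h3⟩, h4⟩
    · rintro ⟨⟨⟨h1, h2⟩, h3⟩, h4⟩
      refine ⟨⟨h1, ?_⟩, h3, h4⟩
      have : i ≠ p.lcm q := fun h => h3 (h ▸ Nat.dvd_lcm_left p q)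
      omega
  -- The lcm is the only common multiple in the range; counting it twice accounts for the extra
  -- factor on the left.
  have hL' : {i ∈ {i ∈ Finset.Icc 1 (p.lcm q) | q ∣ i} | p ∣ i} = {p.lcm q} := by
    ext i
    simp only [Finset.mem_filter, Finset.mem_Icc, Finset.mem_singleton]
    constructor
    · rintro ⟨⟨⟨h1, h2⟩, h3⟩, h4⟩
      exact le_antisymm h2 (Nat.le_of_dvd h1 (Nat.lcm_dvd h4 h3))
    · rintro rfl
      exact ⟨⟨⟨hL, le_rfl⟩, Nat.dvd_lcm_right p q⟩, Nat.dvd_lcm_left p q⟩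
  rw [hI, ← Finset.prod_filter_mul_prod_filter_not (Finset.Icc 1 (p.lcm q)) (p ∣ ·),
    ← Finset.prod_filter_mul_prod_filter_not {i ∈ Finset.Icc 1 (p.lcm q) | ¬ p ∣ i} (q ∣ ·),
    ← Finset.prod_filter_mul_prod_filter_not {i ∈ Finset.Icc 1 (p.lcm q) | q ∣ i} (p ∣ ·), hL',
    Finset.prod_singleton, Finset.filter_comm (q ∣ ·)]
  ac_rfl

theorem numParams_add {p q : ℕ} (hp : 0 < p) (hq : 0 < q) :
    p.lcm q / p + p.lcm q / q + numParams p q = p.lcm q + 1 := by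
  -- Constant weight 2 turns products into powers of two, so cardinalities are read off as
  -- exponents.
  have h := prod_Icc_lcm (fun _ => 2) hp hq
  have h1 := prod_filter_dvd (fun _ => 2) hp (p.lcm q / p)
  have h2 := prod_filter_dvd (fun _ => 2) hq (p.lcm q / q)
  rw [Nat.mul_div_cancel' (Nat.dvd_lcm_left p q)] at h1
  rw [Nat.mul_div_cancel' (Nat.dvd_lcm_right p q)] at h2
  rw [h1, h2] at h
  simp only [Finset.prod_const, Nat.card_Icc, Finset.card_range, ← pow_succ, ← pow_add] at h
  exact (Nat.pow_right_injective le_rfl h).symm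

theorem gcd_mul_numParams {p q : ℕ} (hp : 0 < p) (hq : 0 < q) :
    p.gcd q * numParams p q + p + q = p * q + p.gcd q := by
  have h := congrArg (p.gcd q * ·) (numParams_add hp hq)
  simp only [mul_add, mul_one, Nat.gcd_mul_lcm] at h
  have h1 : p.gcd q * (p.lcm q / p) = q := by
    rw [← Nat.mul_div_assoc _ (Nat.dvd_lcm_left p q), Nat.gcd_mul_lcm, Nat.mul_div_cancel_left _ hp]
  have h2 : p.gcd q * (p.lcm q / q) = p := by
    rw [← Nat.mul_div_assoc _ (Nat.dvd_lcm_right p q), Nat.gcd_mul_lcm, Nat.mul_div_cancel _ hq]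
  rw [h1, h2] at h
  omega

theorem gcd_mul_numParams_sub_one {p q : ℕ} (hp : 0 < p) (hq : 0 < q) :
    (p.gcd q : ℝ) * ((numParams p q : ℝ) - 1) = ((p : ℝ) - 1) * ((q : ℝ) - 1) - 1 := by
  have h : ((p.gcd q * numParams p q + p + q : ℕ) : ℝ) = (p * q + p.gcd q : ℕ) :=
    congrArg _ (gcd_mul_numParams hp hq)
  push_cast at h
  linarith

theorem numParams_eq {p q : ℕ} (hp : 0 < p) (hq : 0 < q) :
    (numParams p q : ℝ) = 1 + (((p : ℝ) - 1) * ((q : ℝ) - 1) - 1) / (p.gcd q : ℝ) := by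
  have hg : (p.gcd q : ℝ) ≠ 0 := Nat.cast_ne_zero.2 (Nat.gcd_pos_of_pos_left q hp).ne'
  rw [← gcd_mul_numParams_sub_one hp hq, mul_div_cancel_left₀ _ hg]
  ring

/-- `N ≤ 1` would mean `pq ≤ p + q`, which for `p, q ≥ 2` leaves only `p = q = 2`. All the growth
estimates rest on this bound. -/
theorem two_le_numParams {p q : ℕ} (hp : 2 ≤ p) (hq : 2 ≤ q) (hpq : 6 ≤ p * q) :
    2 ≤ numParams p q := by
  by_contra h
  have h1 : numParams p q ≤ 1 := by omega
  have h2 := gcd_mul_numParams (show 0 < p by omega) (show 0 < q by omega)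
  have h3 : p.gcd q * numParams p q ≤ p.gcd q := mul_le_of_le_one_right' h1
  have h4 : p * q ≤ p + q := by omega
  nlinarith

theorem cConst_eq {p q : ℕ} (hp : 2 ≤ p) (hq : 2 ≤ q) (hpq : 6 ≤ p * q) :
    cConst p q = (p.lcm q : ℝ) ^ (numParams p q - 1) := by
  have h2 := two_le_numParams hp hq hpq
  have h := numParams_eq (show 0 < p by omega) (show 0 < q by omega)
  rw [cConst, show (((p : ℝ) - 1) * ((q : ℝ) - 1) - 1) / (p.gcd q : ℝ) =
    ((numParams p q - 1 : ℕ) : ℝ) by rw [Nat.cast_sub (by omega)]; push_cast; linarith,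
    Real.rpow_natCast]

theorem lcm_cast_pos {p q : ℕ} (hp : 2 ≤ p) (hq : 2 ≤ q) : (0 : ℝ) < (p.lcm q : ℝ) :=
  Nat.cast_pos.2 (Nat.lcm_pos (by omega) (by omega))

theorem cConst_pos {p q : ℕ} (hp : 2 ≤ p) (hq : 2 ≤ q) : 0 < cConst p q :=
  Real.rpow_pos_of_pos (lcm_cast_pos hp hq) _

theorem cConst_pow_gcd {p q : ℕ} (hp : 2 ≤ p) (hq : 2 ≤ q) (hpq : 6 ≤ p * q) :
    cConst p q ^ p.gcd q = (p.lcm q : ℝ) ^ ((p - 1) * (q - 1) - 1) := by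
  rw [cConst_eq hp hq hpq, ← pow_mul]
  congr 1
  have h2 := two_le_numParams hp hq hpq
  have h := gcd_mul_numParams (show 0 < p by omega) (show 0 < q by omega)
  obtain ⟨a, rfl⟩ : ∃ a, p = a + 1 := ⟨p - 1, by omega⟩
  obtain ⟨b, rfl⟩ : ∃ b, q = b + 1 := ⟨q - 1, by omega⟩
  obtain ⟨N, hN⟩ : ∃ N, numParams (a + 1) (b + 1) = N + 1 :=
    ⟨numParams (a + 1) (b + 1) - 1, by omega⟩
  rw [hN] at h ⊢
  simp only [Nat.add_sub_cancel]
  have : N * (a + 1).gcd (b + 1) + 1 = a * b := by linarith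
  omega

theorem param_eq {p q : ℕ} (hp : 2 ≤ p) (hq : 2 ≤ q) (i : ℕ) :
    param p q i = (i : ℝ) / (p.lcm q : ℝ) := by
  have hL := (lcm_cast_pos hp hq).ne'
  have h : ((p.gcd q * p.lcm q : ℕ) : ℝ) = (p * q : ℕ) := congrArg _ (Nat.gcd_mul_lcm p q)
  push_cast at h
  have hg : (p.gcd q : ℝ) ≠ 0 := Nat.cast_ne_zero.2 (Nat.gcd_pos_of_pos_left q (by omega)).ne'
  rw [param, ← h, mul_comm (p.gcd q : ℝ), mul_div_mul_right _ _ hg]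

theorem param_pos {p q : ℕ} (hp : 2 ≤ p) (hq : 2 ≤ q) {i : ℕ} (hi : i ∈ indices p q) :
    0 < param p q i := by
  rw [indices, Finset.mem_filter, Finset.mem_Icc] at hi
  rw [param_eq hp hq]
  exact div_pos (Nat.cast_pos.2 hi.1.1) (lcm_cast_pos hp hq)

theorem param_lt_one {p q : ℕ} (hp : 2 ≤ p) (hq : 2 ≤ q) {i : ℕ} (hi : i ∈ indices p q) :
    param p q i < 1 := by
  rw [indices, Finset.mem_filter, Finset.mem_Icc,
    show p * q / p.gcd q = p.lcm q from rfl] at hi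
  rw [param_eq hp hq, div_lt_one (lcm_cast_pos hp hq), Nat.cast_lt]
  omega

/-! ### The recurrence for the number of pairs -/

theorem pairDensity_of_not_dvd {p q n : ℕ} (hp : 2 ≤ p) (hq : 2 ≤ q) (h : ¬ p.lcm q ∣ n) :
    pairDensity p q n = 0 := by
  rw [Nat.lcm_dvd_iff, not_and_or] at h
  rw [pairDensity, card_pairs_fin]
  rcases h with h | h
  · simp [numUniform_of_not_dvd hp h]
  · simp [numUniform_of_not_dvd hq h]

/-- The product of the multiples of `l` between `1` and `l * m`. -/
theorem pow_mul_factorial_add (l m d : ℕ) :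
    l ^ (m + d) * (m + d).factorial =
      (l ^ m * m.factorial) * ∏ j ∈ Finset.range d, (l * m + l * (j + 1)) := by
  induction d with
  | zero => simp
  | succ d ih =>
    rw [Finset.prod_range_succ, ← mul_assoc, ← ih, ← add_assoc, pow_succ, Nat.factorial_succ]
    ring

theorem factorial_add_eq (n L : ℕ) :
    (n + L).factorial = n.factorial * ∏ i ∈ Finset.Icc 1 L, (n + i) := by
  induction L with
  | zero => simp
  | succ L ih =>
    rw [Finset.prod_Icc_succ_top (by omega), ← mul_assoc, ← ih, ← add_assoc, Nat.factorial_succ]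
    ring

theorem factorial_eq_numUniform_mul {l L k : ℕ} (hl : 2 ≤ l) (h : l ∣ L) :
    numUniform l (L * k) * (l ^ (L / l * k) * (L / l * k).factorial) = (L * k).factorial := by
  have := numUniform_mul hl (L / l * k)
  rwa [← mul_assoc l, Nat.mul_div_cancel' h] at this

theorem pow_mul_factorial_succ {l L k : ℕ} (hl : 0 < l) (h : l ∣ L) :
    l ^ (L / l * (k + 1)) * (L / l * (k + 1)).factorial =
      (l ^ (L / l * k) * (L / l * k).factorial) *
        ∏ i ∈ Finset.Icc 1 L with l ∣ i, (L * k + i) := by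
  obtain ⟨d, rfl⟩ := h
  rw [Nat.mul_div_cancel_left _ hl, mul_add_one, pow_mul_factorial_add,
    prod_filter_dvd (fun i => l * d * k + i) hl, mul_assoc l d k]

/-- Each of the two cycle-type counts contributes an `n!`, and one of them cancels against the `n!`
in the density. -/
theorem pairDensity_lcm_mul {p q : ℕ} (hp : 2 ≤ p) (hq : 2 ≤ q) (k : ℕ) :
    pairDensity p q (p.lcm q * k) *
      ((p ^ (p.lcm q / p * k) * (p.lcm q / p * k).factorial : ℕ) *
        (q ^ (p.lcm q / q * k) * (p.lcm q / q * k).factorial : ℕ)) =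
      ((p.lcm q * k).factorial : ℝ) := by
  have hn : ((p.lcm q * k).factorial : ℝ) ≠ 0 := by positivity
  rw [pairDensity, card_pairs_fin, div_mul_eq_mul_div, div_eq_iff hn]
  have h1 := factorial_eq_numUniform_mul (k := k) hp (Nat.dvd_lcm_left p q)
  have h2 := factorial_eq_numUniform_mul (k := k) hq (Nat.dvd_lcm_right p q)
  conv_rhs => rw [show ((p.lcm q * k).factorial : ℝ) * ((p.lcm q * k).factorial : ℝ) =
    (((p.lcm q * k).factorial * (p.lcm q * k).factorial : ℕ) : ℝ) by push_cast; rfl]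
  conv_rhs => rw [← h1]
  conv_rhs => rw [h1]
  nth_rewrite 1 [← h1]
  rw [← h2]
  push_cast
  ring

theorem pairDensity_zero {p q : ℕ} (hp : 2 ≤ p) (hq : 2 ≤ q) : pairDensity p q 0 = 1 := by
  simpa using pairDensity_lcm_mul hp hq 0

/-- With `L` the lcm, passing from `k` to `k + 1` multiplies the density by the product of `Lk + i`
over `1 ≤ i ≤ L`, divided by the subproducts over multiples of `p` and of `q`. By
inclusion-exclusion only the indices in `I` survive, over one factor `L(k + 1)`. Extracting `L` from
each of the `N` factors leaves `L^(N-1) = c`. -/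
theorem pairDensity_succ {p q : ℕ} (hp : 2 ≤ p) (hq : 2 ≤ q) (hpq : 6 ≤ p * q) (k : ℕ) :
    pairDensity p q (p.lcm q * (k + 1)) * (k + 1) =
      cConst p q * (∏ i ∈ indices p q, (param p q i + k)) * pairDensity p q (p.lcm q * k) := by
  have hL := lcm_cast_pos hp hq
  have hp0 : 0 < p := by omega
  have hq0 : 0 < q := by omega
  have h := pairDensity_lcm_mul hp hq (k + 1)
  rw [pow_mul_factorial_succ hp0 (Nat.dvd_lcm_left p q),
    pow_mul_factorial_succ hq0 (Nat.dvd_lcm_right p q), mul_add_one, factorial_add_eq] at h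
  have hk := pairDensity_lcm_mul hp hq k
  have hincl := prod_Icc_lcm (fun i => p.lcm q * k + i) hp0 hq0
  have hI : ((∏ i ∈ indices p q, (p.lcm q * k + i) : ℕ) : ℝ) =
      (p.lcm q : ℝ) * cConst p q * ∏ i ∈ indices p q, (param p q i + k) := by
    rw [cConst_eq hp hq hpq, ← pow_succ',
      Nat.sub_add_cancel (by have := two_le_numParams hp hq hpq; omega), numParams,
      Finset.pow_card_mul_prod]
    push_cast
    refine Finset.prod_congr rfl fun i _ => ?_
    rw [param_eq hp hq]
    field_simp
    ring
  set Bp := ∏ i ∈ Finset.Icc 1 (p.lcm q) with p ∣ i, (p.lcm q * k + i) with hBp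
  set Bq := ∏ i ∈ Finset.Icc 1 (p.lcm q) with q ∣ i, (p.lcm q * k + i) with hBq
  set W := ∏ i ∈ Finset.Icc 1 (p.lcm q), (p.lcm q * k + i)
  have hBp0 : (Bp : ℝ) ≠ 0 := by
    rw [Nat.cast_ne_zero, hBp, Finset.prod_ne_zero_iff]
    intro i hi
    simp only [Finset.mem_filter, Finset.mem_Icc] at hi
    omega
  have hBq0 : (Bq : ℝ) ≠ 0 := by
    rw [Nat.cast_ne_zero, hBq, Finset.prod_ne_zero_iff]
    intro i hi
    simp only [Finset.mem_filter, Finset.mem_Icc] at hi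
    omega
  have hincl' : (W : ℝ) * ((p.lcm q : ℝ) * k + p.lcm q) = (Bp : ℝ) * Bq *
      ((p.lcm q : ℝ) * cConst p q * ∏ i ∈ indices p q, (param p q i + k)) := by
    rw [← hI]
    exact_mod_cast hincl
  set P := p ^ (p.lcm q / p * k) * (p.lcm q / p * k).factorial
  set Q := q ^ (p.lcm q / q * k) * (p.lcm q / q * k).factorial
  have hP : (P : ℝ) ≠ 0 := by positivity
  have hQ : (Q : ℝ) ≠ 0 := by positivity
  push_cast at h
  rw [← hk] at h
  have hne : (P : ℝ) * Q * Bp * Bq * p.lcm q ≠ 0 := by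
    have := hL.ne'
    positivity
  apply mul_right_cancel₀ hne
  rw [mul_add_one] at *
  linear_combination ((p.lcm q : ℝ) * k + p.lcm q) * h +
    pairDensity p q (p.lcm q * k) * P * Q * hincl'

/-! ### The hypergeometric series and its logarithmic derivative -/

theorem coeff_fSeries (p q k : ℕ) :
    PowerSeries.coeff k (fSeries p q) =
      (∏ i ∈ indices p q, (ascPochhammer ℝ k).eval (param p q i)) / (k.factorial : ℝ) := by
  simp [fSeries, hypergeometricSeries]

theorem coeff_fSeries_succ (p q k : ℕ) :
    PowerSeries.coeff (k + 1) (fSeries p q) * (k + 1) =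
      (∏ i ∈ indices p q, (param p q i + k)) * PowerSeries.coeff k (fSeries p q) := by
  rw [coeff_fSeries, coeff_fSeries]
  simp only [ascPochhammer_succ_eval, Finset.prod_mul_distrib, Nat.factorial_succ]
  have h : (k.factorial : ℝ) ≠ 0 := by positivity
  have h' : (k : ℝ) + 1 ≠ 0 := by positivity
  push_cast
  field_simp

theorem coeff_zero_fSeries (p q : ℕ) : PowerSeries.coeff 0 (fSeries p q) = 1 := by
  simp [coeff_fSeries]

theorem pairDensity_eq_coeff {p q : ℕ} (hp : 2 ≤ p) (hq : 2 ≤ q) (hpq : 6 ≤ p * q) (k : ℕ) :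
    pairDensity p q (p.lcm q * k) = cConst p q ^ k * PowerSeries.coeff k (fSeries p q) := by
  induction k with
  | zero => simp [pairDensity_zero hp hq, coeff_fSeries]
  | succ k ih =>
    have h' : (k : ℝ) + 1 ≠ 0 := by positivity
    apply mul_right_cancel₀ h'
    rw [pairDensity_succ hp hq hpq, ih, mul_assoc _ _ ((k : ℝ) + 1), coeff_fSeries_succ]
    ring

open PowerSeries in
theorem coeff_subst_C_mul_X_pow {R : Type*} [CommRing R] (c : R) {L : ℕ} (hL : 0 < L)
    (g : PowerSeries R) (n : ℕ) :
    coeff n (subst (C c * X ^ L : PowerSeries R) g) =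
      if L ∣ n then c ^ (n / L) * coeff (n / L) g else 0 := by
  have hs : HasSubst (C c * X ^ L : PowerSeries R) :=
    HasSubst.of_constantCoeff_zero' (by simp [hL.ne'])
  have hpow : ∀ d, coeff n ((C c * X ^ L : PowerSeries R) ^ d) =
      if n = L * d then c ^ d else 0 := by
    intro d
    rw [mul_pow, ← map_pow, coeff_C_mul, ← pow_mul, coeff_X_pow]
    simp
  rw [coeff_subst' hs]
  simp only [hpow]
  split_ifs with h
  · obtain ⟨m, rfl⟩ := h
    rw [Nat.mul_div_cancel_left m hL, finsum_eq_single _ m]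
    · simp [mul_comm]
    · intro d hd
      rw [if_neg (fun h => hd (Nat.eq_of_mul_eq_mul_left hL h).symm), smul_zero]
  · rw [finsum_eq_zero_of_forall_eq_zero]
    intro d
    rw [if_neg (fun e => h ⟨d, e⟩), smul_zero]

/-- The series `x f'(x) / f(x)`. -/
noncomputable def logDerivSeries (p q : ℕ) : PowerSeries ℝ :=
  PowerSeries.X * PowerSeries.derivative ℝ (fSeries p q) * (fSeries p q)⁻¹

theorem constantCoeff_fSeries (p q : ℕ) : PowerSeries.constantCoeff (fSeries p q) = 1 := by
  rw [← PowerSeries.coeff_zero_eq_constantCoeff_apply, coeff_zero_fSeries]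

theorem logDerivSeries_mul (p q : ℕ) :
    logDerivSeries p q * fSeries p q =
      PowerSeries.X * PowerSeries.derivative ℝ (fSeries p q) := by
  rw [logDerivSeries, mul_assoc, PowerSeries.inv_mul_cancel _ (by simp [constantCoeff_fSeries]),
    mul_one]

theorem coeff_X_mul_derivative {R : Type*} [CommSemiring R] (f : PowerSeries R) (n : ℕ) :
    PowerSeries.coeff n (PowerSeries.X * PowerSeries.derivative R f) =
      n * PowerSeries.coeff n f := by
  cases n with
  | zero => simp
  | succ n =>
    rw [PowerSeries.coeff_succ_X_mul, PowerSeries.coeff_derivative]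
    push_cast
    ring

open PowerSeries in
theorem Hcirc_eq_subst {p q : ℕ} (hp : 2 ≤ p) (hq : 2 ≤ q) (hpq : 6 ≤ p * q) :
    Hcirc ℝ p q = (p.lcm q : ℝ) • (subst (C (cConst p q) * X ^ p.lcm q : PowerSeries ℝ)
      (logDerivSeries p q) : PowerSeries ℝ) := by
  have hL : 0 < p.lcm q := Nat.lcm_pos (by omega) (by omega)
  have hs : HasSubst (C (cConst p q) * X ^ p.lcm q : PowerSeries ℝ) :=
    HasSubst.of_constantCoeff_zero' (by simp [hL.ne'])
  set F : PowerSeries ℝ := subst (C (cConst p q) * X ^ p.lcm q : PowerSeries ℝ) (fSeries p q)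
    with hF
  have hFn : ∀ n, coeff n F = pairDensity p q n := by
    intro n
    rw [hF, coeff_subst_C_mul_X_pow _ hL]
    split_ifs with h
    · obtain ⟨m, rfl⟩ := h
      rw [Nat.mul_div_cancel_left m hL, pairDensity_eq_coeff hp hq hpq]
    · rw [pairDensity_of_not_dvd hp hq h]
  -- Both sides equal `z F'`: the left one by the orbit splitting, the right one by the chain rule,
  -- read off coefficientwise. Then `F`, with constant term 1, is cancelled.
  have hmul : Hcirc ℝ p q * F = (p.lcm q : ℝ) •
      (subst (C (cConst p q) * X ^ p.lcm q : PowerSeries ℝ) (logDerivSeries p q) * F) := by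
    rw [hF, ← subst_mul hs, logDerivSeries_mul]
    ext n
    rw [coeff_mul, coeff_smul, coeff_subst_C_mul_X_pow _ hL, coeff_X_mul_derivative,
      Finset.Nat.sum_antidiagonal_eq_sum_range_succ_mk]
    simp only [← hF, hFn, Hcirc, coeff_mk]
    rw [← pairDensity_mul]
    split_ifs with h
    · obtain ⟨m, rfl⟩ := h
      rw [Nat.mul_div_cancel_left m hL, pairDensity_eq_coeff hp hq hpq]
      simp only [smul_eq_mul]
      push_cast
      ring
    · rw [pairDensity_of_not_dvd hp hq h, mul_zero, smul_zero]
  rw [← smul_mul_assoc] at hmul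
  refine mul_right_cancel₀ (fun h0 => ?_) hmul
  have := hFn 0
  rw [h0, pairDensity_zero hp hq] at this
  simp at this

theorem numRooted_eq {p q : ℕ} (hp : 2 ≤ p) (hq : 2 ≤ q) (hpq : 6 ≤ p * q) (n : ℕ) :
    (numRooted p q n : ℝ) = if p.lcm q ∣ n then (p.lcm q : ℝ) *
      (cConst p q ^ (n / p.lcm q) * PowerSeries.coeff (n / p.lcm q) (logDerivSeries p q))
      else 0 := by
  have h := congrArg (PowerSeries.coeff n) (Hcirc_eq_subst hp hq hpq)
  rw [PowerSeries.coeff_smul, coeff_subst_C_mul_X_pow _ (Nat.lcm_pos (by omega) (by omega)),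
    Hcirc, PowerSeries.coeff_mk] at h
  rw [h]
  split_ifs <;> simp

theorem numRooted_lcm_mul {p q : ℕ} (hp : 2 ≤ p) (hq : 2 ≤ q) (hpq : 6 ≤ p * q) (k : ℕ) :
    (numRooted p q (p.lcm q * k) : ℝ) =
      p.lcm q * (cConst p q ^ k * PowerSeries.coeff k (logDerivSeries p q)) := by
  rw [numRooted_eq hp hq hpq, if_pos (Nat.dvd_mul_right _ _),
    Nat.mul_div_cancel_left k (Nat.lcm_pos (by omega) (by omega))]

/-- Up to a positive factor the coefficient counts hypermaps; its nonnegativity is obtained from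
combinatorics. -/
theorem coeff_logDerivSeries_nonneg {p q : ℕ} (hp : 2 ≤ p) (hq : 2 ≤ q) (hpq : 6 ≤ p * q)
    (k : ℕ) : 0 ≤ PowerSeries.coeff k (logDerivSeries p q) := by
  have h := numRooted_lcm_mul hp hq hpq k
  have h1 : (0 : ℝ) ≤ numRooted p q (p.lcm q * k) := Nat.cast_nonneg _
  have h2 : 0 < (p.lcm q : ℝ) * cConst p q ^ k :=
    mul_pos (lcm_cast_pos hp hq) (pow_pos (cConst_pos hp hq) k)
  rw [h, ← mul_assoc] at h1
  exact nonneg_of_mul_nonneg_right h1 h2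

/-! ### Growth of the coefficients of `f` -/

/-- The ratio of two consecutive coefficients of `f`. -/
noncomputable def coeffRatio (p q k : ℕ) : ℝ :=
  (∏ i ∈ indices p q, (param p q i + k)) / ((k : ℝ) + 1)

theorem coeff_fSeries_succ_eq (p q k : ℕ) :
    PowerSeries.coeff (k + 1) (fSeries p q) =
      coeffRatio p q k * PowerSeries.coeff k (fSeries p q) := by
  rw [coeffRatio, div_mul_eq_mul_div, ← coeff_fSeries_succ,
    mul_div_cancel_right₀ _ (by positivity)]

theorem prod_param_add_pos {p q : ℕ} (hp : 2 ≤ p) (hq : 2 ≤ q) (k : ℕ) :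
    0 < ∏ i ∈ indices p q, (param p q i + (k : ℝ)) :=
  Finset.prod_pos fun _ hi => add_pos_of_pos_of_nonneg (param_pos hp hq hi) k.cast_nonneg

theorem coeffRatio_pos {p q : ℕ} (hp : 2 ≤ p) (hq : 2 ≤ q) (k : ℕ) : 0 < coeffRatio p q k :=
  div_pos (prod_param_add_pos hp hq k) (by positivity)

theorem coeff_fSeries_pos {p q : ℕ} (hp : 2 ≤ p) (hq : 2 ≤ q) (k : ℕ) :
    0 < PowerSeries.coeff k (fSeries p q) := by
  induction k with
  | zero => simp [coeff_zero_fSeries]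
  | succ k ih =>
    rw [coeff_fSeries_succ_eq]
    exact mul_pos (coeffRatio_pos hp hq k) ih

/-- One parameter is paired with the denominator: `(aᵢ + k)/(k + 1)` is nondecreasing because `aᵢ <
1`, and the remaining factors grow with `k`. -/
theorem coeffRatio_monotone {p q : ℕ} (hp : 2 ≤ p) (hq : 2 ≤ q) (hpq : 6 ≤ p * q) :
    Monotone (coeffRatio p q) := by
  refine monotone_nat_of_le_succ fun k => ?_
  have hN := two_le_numParams hp hq hpq
  obtain ⟨i, hi⟩ : (indices p q).Nonempty := Finset.card_pos.1 (by rw [numParams] at hN; omega)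
  have hk : (0 : ℝ) ≤ k := k.cast_nonneg
  have h0 := param_pos hp hq hi
  have h1 := param_lt_one hp hq hi
  rw [coeffRatio, coeffRatio, ← Finset.mul_prod_erase _ _ hi, ← Finset.mul_prod_erase _ _ hi,
    mul_div_right_comm, mul_div_right_comm]
  refine mul_le_mul ?_ ?_ ?_ ?_
  · rw [div_le_div_iff₀ (by positivity) (by positivity)]
    push_cast
    nlinarith
  · refine Finset.prod_le_prod (fun j hj => ?_) fun j hj => ?_
    · exact add_nonneg (param_pos hp hq (Finset.mem_of_mem_erase hj)).le hk
    · push_cast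
      linarith
  · exact Finset.prod_nonneg fun j hj =>
      add_nonneg (param_pos hp hq (Finset.mem_of_mem_erase hj)).le hk
  · positivity

theorem exists_mul_le_coeffRatio {p q : ℕ} (hp : 2 ≤ p) (hq : 2 ≤ q) (hpq : 6 ≤ p * q) :
    ∃ δ : ℝ, 0 < δ ∧ ∀ k : ℕ, δ * ((k : ℝ) + 1) ≤ coeffRatio p q k := by
  have hN := two_le_numParams hp hq hpq
  -- Since `aᵢ < 1`, `aᵢ + k ≥ aᵢ (k + 1)`; with `N ≥ 2` at least one power of `k + 1` survives the
  -- division.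
  refine ⟨∏ i ∈ indices p q, param p q i, Finset.prod_pos fun i hi => param_pos hp hq hi,
    fun k => ?_⟩
  have hk : (0 : ℝ) ≤ k := k.cast_nonneg
  have hpos : 0 ≤ ∏ i ∈ indices p q, param p q i :=
    Finset.prod_nonneg fun i hi => (param_pos hp hq hi).le
  rw [coeffRatio, le_div_iff₀ (by positivity), mul_assoc, ← sq]
  calc (∏ i ∈ indices p q, param p q i) * ((k : ℝ) + 1) ^ 2
      ≤ (∏ i ∈ indices p q, param p q i) * ((k : ℝ) + 1) ^ (indices p q).card :=
        mul_le_mul_of_nonneg_left (pow_le_pow_right₀ (by linarith) hN) hpos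
    _ = ∏ i ∈ indices p q, (param p q i * ((k : ℝ) + 1)) := Finset.prod_mul_pow_card
    _ ≤ _ := Finset.prod_le_prod
        (fun i hi => mul_nonneg (param_pos hp hq hi).le (by linarith)) fun i hi => by
          have := param_lt_one hp hq hi
          nlinarith

theorem tendsto_coeffRatio {p q : ℕ} (hp : 2 ≤ p) (hq : 2 ≤ q) (hpq : 6 ≤ p * q) :
    Filter.Tendsto (coeffRatio p q) Filter.atTop Filter.atTop := by
  obtain ⟨δ, hδ, h⟩ := exists_mul_le_coeffRatio hp hq hpq
  refine Filter.tendsto_atTop_mono h (Filter.Tendsto.const_mul_atTop hδ ?_)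
  exact Filter.tendsto_atTop_add_const_right _ _ tendsto_natCast_atTop_atTop

theorem radius_fSeries {p q : ℕ} (hp : 2 ≤ p) (hq : 2 ≤ q) (hpq : 6 ≤ p * q) :
    (FormalMultilinearSeries.ofScalars ℝ
      (fun k : ℕ => PowerSeries.coeff k (fSeries p q))).radius = 0 := by
  refine FormalMultilinearSeries.ofScalars_radius_eq_zero_of_tendsto ℝ _
    ((tendsto_coeffRatio hp hq hpq).congr fun k => ?_)
  rw [Nat.succ_eq_add_one, coeff_fSeries_succ_eq, norm_mul,
    mul_div_cancel_right₀ _ (norm_ne_zero_iff.2 (coeff_fSeries_pos hp hq k).ne'),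
    Real.norm_of_nonneg (coeffRatio_pos hp hq k).le]

/-! ### Comparing the coefficients of `x f'/f` with those of `f` -/

theorem sum_logDerivSeries (p q k : ℕ) :
    ∑ i ∈ Finset.range (k + 1), PowerSeries.coeff i (logDerivSeries p q) *
      PowerSeries.coeff (k - i) (fSeries p q) = k * PowerSeries.coeff k (fSeries p q) := by
  rw [← coeff_X_mul_derivative, ← logDerivSeries_mul, PowerSeries.coeff_mul,
    Finset.Nat.sum_antidiagonal_eq_sum_range_succ_mk]

theorem coeff_zero_logDerivSeries (p q : ℕ) :
    PowerSeries.coeff 0 (logDerivSeries p q) = 0 := by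
  simp [logDerivSeries]

theorem coeff_logDerivSeries_succ (p q k : ℕ) :
    PowerSeries.coeff (k + 1) (logDerivSeries p q) +
      ∑ i ∈ Finset.range k, PowerSeries.coeff (i + 1) (logDerivSeries p q) *
        PowerSeries.coeff (k - i) (fSeries p q) =
      (k + 1) * PowerSeries.coeff (k + 1) (fSeries p q) := by
  have h := sum_logDerivSeries p q (k + 1)
  rw [Finset.sum_range_succ, Finset.sum_range_succ', coeff_zero_logDerivSeries, Nat.sub_self,
    coeff_zero_fSeries] at h
  push_cast at h
  rw [← h]
  ring

/-- In the recurrence for `h_{k+1}`, each `A_{k-i}` is at most `A_{k+1}/A_k` times `A_{k-i-1}`. The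
correction sum is thus at most `A_{k+1}/A_k` times the convolution at level `k`, which is `k A_k`.
So it takes away at most `k A_{k+1}` from `(k + 1) A_{k+1}`. -/
theorem coeff_fSeries_le_coeff_logDerivSeries {p q : ℕ} (hp : 2 ≤ p) (hq : 2 ≤ q)
    (hpq : 6 ≤ p * q) (k : ℕ) :
    PowerSeries.coeff (k + 1) (fSeries p q) ≤
      PowerSeries.coeff (k + 1) (logDerivSeries p q) := by
  have h := coeff_logDerivSeries_succ p q k
  have hle : ∑ i ∈ Finset.range k, PowerSeries.coeff (i + 1) (logDerivSeries p q) *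
      PowerSeries.coeff (k - i) (fSeries p q) ≤ k * PowerSeries.coeff (k + 1) (fSeries p q) := by
    have hk := sum_logDerivSeries p q k
    rw [Finset.sum_range_succ', coeff_zero_logDerivSeries, zero_mul, add_zero] at hk
    rw [coeff_fSeries_succ_eq, mul_left_comm, ← hk, Finset.mul_sum]
    refine Finset.sum_le_sum fun i hi => ?_
    rw [Finset.mem_range] at hi
    rw [show k - i = (k - (i + 1)) + 1 by omega, coeff_fSeries_succ_eq, mul_left_comm]
    refine mul_le_mul_of_nonneg_right (coeffRatio_monotone hp hq hpq (by omega)) ?_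
    exact mul_nonneg (coeff_logDerivSeries_nonneg hp hq hpq _) (coeff_fSeries_pos hp hq _).le
  linarith

theorem coeff_logDerivSeries_le {p q : ℕ} (hp : 2 ≤ p) (hq : 2 ≤ q) (hpq : 6 ≤ p * q) (k : ℕ) :
    PowerSeries.coeff k (logDerivSeries p q) ≤ k * PowerSeries.coeff k (fSeries p q) := by
  rw [← sum_logDerivSeries, Finset.sum_range_succ, Nat.sub_self, coeff_zero_fSeries, mul_one]
  exact le_add_of_nonneg_left (Finset.sum_nonneg fun i _ =>
    mul_nonneg (coeff_logDerivSeries_nonneg hp hq hpq _) (coeff_fSeries_pos hp hq _).le)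

theorem numRooted_ne_zero_iff {p q : ℕ} (hp : 2 ≤ p) (hq : 2 ≤ q) (hpq : 6 ≤ p * q) (n : ℕ) :
    numRooted p q n ≠ 0 ↔ 0 < n ∧ p.lcm q ∣ n := by
  have hL : 0 < p.lcm q := Nat.lcm_pos (by omega) (by omega)
  constructor
  · intro h
    by_contra hn
    refine h ((Nat.cast_eq_zero (R := ℝ)).1 ?_)
    by_cases hd : p.lcm q ∣ n
    · obtain rfl : n = 0 := by
        by_contra h0
        exact hn ⟨Nat.pos_of_ne_zero h0, hd⟩
      rw [numRooted_eq hp hq hpq]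
      simp [coeff_zero_logDerivSeries]
    · rw [numRooted_eq hp hq hpq, if_neg hd]
  · rintro ⟨hn, ⟨k, rfl⟩⟩
    obtain ⟨m, rfl⟩ : ∃ m, k = m + 1 :=
      Nat.exists_eq_succ_of_ne_zero fun h => by simp [h] at hn
    rw [← Nat.cast_ne_zero (R := ℝ), numRooted_lcm_mul hp hq hpq]
    have h := (coeff_fSeries_pos hp hq (m + 1)).trans_le
      (coeff_fSeries_le_coeff_logDerivSeries hp hq hpq m)
    exact (mul_pos (lcm_cast_pos hp hq) (mul_pos (pow_pos (cConst_pos hp hq) _) h)).ne'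

/-- Log-convexity of a positive sequence with monotone ratios. -/
theorem mul_le_mul_of_monotone_ratio {u ρ : ℕ → ℝ} (hu : ∀ n, 0 ≤ u n) (hρ : ∀ n, 0 ≤ ρ n)
    (hmono : Monotone ρ) (hs : ∀ n, u (n + 1) = ρ n * u n) (m a b : ℕ) :
    u (m + a) * u (m + b) ≤ u m * u (m + a + b) := by
  induction a with
  | zero => exact le_rfl
  | succ a ih =>
    rw [← add_assoc, hs, show m + a + 1 + b = (m + a + b) + 1 by omega, hs, mul_assoc,
      mul_left_comm (u m)]
    exact mul_le_mul (hmono (by omega)) ih (mul_nonneg (hu _) (hu _)) (hρ _)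

theorem coeff_fSeries_convolution_le {p q : ℕ} (hp : 2 ≤ p) (hq : 2 ≤ q) (hpq : 6 ≤ p * q) :
    ∃ M : ℝ, ∀ k : ℕ, ∑ i ∈ Finset.range (k + 3), PowerSeries.coeff (i + 1) (fSeries p q) *
      PowerSeries.coeff (k + 3 - i) (fSeries p q) ≤
        M / ((k : ℝ) + 1) * PowerSeries.coeff (k + 4) (fSeries p q) := by
  obtain ⟨δ, hδ, hδk⟩ := exists_mul_le_coeffRatio hp hq hpq
  set A : ℕ → ℝ := fun k => PowerSeries.coeff k (fSeries p q) with hA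
  have hpos : ∀ n, 0 ≤ A n := fun n => (coeff_fSeries_pos hp hq n).le
  have hs : ∀ n, A (n + 1) = coeffRatio p q n * A n := coeff_fSeries_succ_eq p q
  have hlog := mul_le_mul_of_monotone_ratio hpos (fun n => (coeffRatio_pos hp hq n).le)
    (coeffRatio_monotone hp hq hpq) hs
  -- The two end terms are `A_1 A_{k+3}`. By log-convexity each of the `k + 1` middle terms is at
  -- most `A_2 A_{k+2}`. Every step up in index gains a factor at least `δ (k + 1)`, which gives the
  -- two summands of the constant.
  refine ⟨2 * A 1 / δ + A 2 / δ ^ 2, fun k => ?_⟩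
  change ∑ i ∈ Finset.range (k + 3), A (i + 1) * A (k + 3 - i) ≤ _ * A (k + 4)
  have hk : (0 : ℝ) < (k : ℝ) + 1 := by positivity
  have h4 : δ * ((k : ℝ) + 1) * A (k + 3) ≤ A (k + 4) := by
    rw [hs (k + 3)]
    refine mul_le_mul_of_nonneg_right (le_trans ?_ (hδk (k + 3))) (hpos _)
    push_cast
    nlinarith
  have h3 : δ * ((k : ℝ) + 1) * A (k + 2) ≤ A (k + 3) := by
    rw [hs (k + 2)]
    refine mul_le_mul_of_nonneg_right (le_trans ?_ (hδk (k + 2))) (hpos _)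
    push_cast
    nlinarith
  have hmid : ∑ i ∈ Finset.range (k + 1), A (i + 2) * A (k + 2 - i) ≤
      ((k : ℝ) + 1) * (A 2 * A (k + 2)) := by
    have := Finset.sum_le_card_nsmul (Finset.range (k + 1))
      (fun i => A (i + 2) * A (k + 2 - i)) (A 2 * A (k + 2)) fun i hi => by
        rw [Finset.mem_range] at hi
        have := hlog 2 i (k - i)
        rwa [add_comm 2 i, show 2 + (k - i) = k + 2 - i by omega,
          show i + 2 + (k - i) = k + 2 by omega] at this
    rw [Finset.card_range, nsmul_eq_mul] at this
    exact_mod_cast this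
  rw [Finset.sum_range_succ, Finset.sum_range_succ']
  simp only [Nat.sub_zero, zero_add, show ∀ i, k + 3 - (i + 1) = k + 2 - i by omega,
    show k + 2 - (k + 1) = 1 by omega, show k + 2 + 1 = k + 3 by omega, add_assoc, Nat.reduceAdd]
  have e3 : A (k + 3) ≤ A (k + 4) / (δ * ((k : ℝ) + 1)) := by
    rw [le_div_iff₀ (by positivity)]
    linarith
  have e2 : A (k + 2) ≤ A (k + 4) / (δ * ((k : ℝ) + 1)) ^ 2 := by
    rw [le_div_iff₀ (by positivity)]
    calc A (k + 2) * (δ * ((k : ℝ) + 1)) ^ 2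
        = (δ * ((k : ℝ) + 1)) * (δ * ((k : ℝ) + 1) * A (k + 2)) := by ring
      _ ≤ (δ * ((k : ℝ) + 1)) * A (k + 3) := mul_le_mul_of_nonneg_left h3 (by positivity)
      _ ≤ _ := h4
  calc _ ≤ ((k : ℝ) + 1) * (A 2 * A (k + 2)) + (A 1 * A (k + 3) + A (k + 3) * A 1) := by
        exact add_le_add hmid le_rfl
    _ = ((k : ℝ) + 1) * A 2 * A (k + 2) + 2 * A 1 * A (k + 3) := by ring
    _ ≤ ((k : ℝ) + 1) * A 2 * (A (k + 4) / (δ * ((k : ℝ) + 1)) ^ 2) +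
        2 * A 1 * (A (k + 4) / (δ * ((k : ℝ) + 1))) :=
      add_le_add (mul_le_mul_of_nonneg_left e2 (mul_nonneg hk.le (hpos 2)))
        (mul_le_mul_of_nonneg_left e3 (mul_nonneg zero_le_two (hpos 1)))
    _ = _ := by
      field_simp
      ring

theorem coeff_logDerivSeries_isEquivalent {p q : ℕ} (hp : 2 ≤ p) (hq : 2 ≤ q)
    (hpq : 6 ≤ p * q) :
    Asymptotics.IsEquivalent Filter.atTop
      (fun k : ℕ => PowerSeries.coeff k (logDerivSeries p q))
      (fun k : ℕ => (k : ℝ) * PowerSeries.coeff k (fSeries p q)) := by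
  obtain ⟨M, hM⟩ := coeff_fSeries_convolution_le hp hq hpq
  refine Asymptotics.isEquivalent_of_tendsto_one ?_
  rw [← Filter.tendsto_add_atTop_iff_nat 4]
  have hlim : Filter.Tendsto (fun k : ℕ => 1 - M / ((k : ℝ) + 1)) Filter.atTop (nhds 1) := by
    have h : Filter.Tendsto (fun k : ℕ => M / ((k : ℝ) + 1)) Filter.atTop (nhds 0) :=
      tendsto_const_nhds.div_atTop
        (Filter.tendsto_atTop_add_const_right _ _ tendsto_natCast_atTop_atTop)
    simpa using h.const_sub 1
  refine tendsto_of_tendsto_of_tendsto_of_le_of_le hlim tendsto_const_nhds (fun k => ?_)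
    fun k => ?_
  · have hA := coeff_fSeries_pos hp hq (k + 4)
    have hk : (0 : ℝ) < ((k + 4 : ℕ) : ℝ) := by positivity
    rw [Pi.div_apply, le_div_iff₀ (mul_pos hk hA)]
    have h := coeff_logDerivSeries_succ p q (k + 3)
    -- The bound `h_j ≤ j A_j ≤ (k + 4) A_j` reduces the correction to the convolution of `A` with
    -- itself.
    have hle : ∑ i ∈ Finset.range (k + 3), PowerSeries.coeff (i + 1) (logDerivSeries p q) *
        PowerSeries.coeff (k + 3 - i) (fSeries p q) ≤
        ((k + 4 : ℕ) : ℝ) * ∑ i ∈ Finset.range (k + 3), PowerSeries.coeff (i + 1) (fSeries p q) *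
          PowerSeries.coeff (k + 3 - i) (fSeries p q) := by
      rw [Finset.mul_sum]
      refine Finset.sum_le_sum fun i hi => ?_
      rw [Finset.mem_range] at hi
      rw [← mul_assoc]
      refine mul_le_mul_of_nonneg_right ?_ (coeff_fSeries_pos hp hq _).le
      refine (coeff_logDerivSeries_le hp hq hpq _).trans
        (mul_le_mul_of_nonneg_right ?_ (coeff_fSeries_pos hp hq _).le)
      exact Nat.cast_le.2 (by omega)
    have h2 := mul_le_mul_of_nonneg_left (hM k) hk.le
    have e : (((k + 3 : ℕ) : ℝ) + 1) = ((k + 4 : ℕ) : ℝ) := by push_cast; ring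
    rw [e] at h
    change _ + _ = _ * PowerSeries.coeff (k + 4) _ at h
    change _ ≤ PowerSeries.coeff (k + 3 + 1) (logDerivSeries p q)
    linarith
  · have hA := coeff_fSeries_pos hp hq (k + 4)
    rw [Pi.div_apply, div_le_one (by positivity)]
    exact coeff_logDerivSeries_le hp hq hpq (k + 4)

/-! ### Asymptotics by Euler's limit and Stirling's formula -/

section

open Filter Asymptotics Topology

theorem eval_ascPochhammer_eq_prod (a : ℝ) (k : ℕ) :
    (ascPochhammer ℝ k).eval a = ∏ j ∈ Finset.range k, (a + j) := by
  induction k with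
  | zero => simp
  | succ k ih => rw [ascPochhammer_succ_eval, ih, Finset.prod_range_succ]

/-- Euler's limit for the Pochhammer symbol. -/
theorem ascPochhammer_isEquivalent {a : ℝ} (ha : 0 < a) :
    (fun k : ℕ => (ascPochhammer ℝ k).eval a) ~[atTop]
      fun k : ℕ => (k : ℝ) ^ (a - 1) * (k.factorial : ℝ) / Real.Gamma a := by
  have hΓ := Real.Gamma_pos_of_pos ha
  have h1 : Real.GammaSeq a ~[atTop] fun _ => Real.Gamma a :=
    (isEquivalent_const_iff_tendsto hΓ.ne').2 (Real.GammaSeq_tendsto_Gamma a)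
  have h2 : (fun k : ℕ => a + (k : ℝ)) ~[atTop] fun k : ℕ => (k : ℝ) := by
    refine IsEquivalent.const_add_of_norm_tendsto_atTop IsEquivalent.refl ?_
    exact tendsto_norm_atTop_atTop.comp tendsto_natCast_atTop_atTop
  have h3 : (fun k : ℕ => (k : ℝ) ^ a * (k.factorial : ℝ)) ~[atTop]
      fun k : ℕ => (k : ℝ) ^ a * (k.factorial : ℝ) := IsEquivalent.refl
  -- The denominator of `GammaSeq` has one factor more than the Pochhammer symbol, namely `a + k ~
  -- k`; this produces the exponent `a - 1`.
  have h4 := h3.div (h1.mul h2)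
  refine (h4.congr_left ?_).congr_right ?_
  · filter_upwards [eventually_gt_atTop 0] with k hk
    have hk' : (0 : ℝ) < k := Nat.cast_pos.2 hk
    have hprod : 0 < ∏ j ∈ Finset.range k, (a + (j : ℝ)) :=
      Finset.prod_pos fun j _ => by positivity
    have hr : 0 < (k : ℝ) ^ a := Real.rpow_pos_of_pos hk' a
    simp only [Pi.div_apply, Pi.mul_apply]
    rw [eval_ascPochhammer_eq_prod, Real.GammaSeq, Finset.prod_range_succ]
    have : (k.factorial : ℝ) ≠ 0 := by positivity
    field_simp
  · filter_upwards [eventually_gt_atTop 0] with k hk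
    have hk' : (0 : ℝ) < k := Nat.cast_pos.2 hk
    simp only [Pi.div_apply, Pi.mul_apply]
    rw [Real.rpow_sub_one hk'.ne']
    field_simp

/-- The `N` Pochhammer symbols give `N` factorials and the coefficient of `f` divides by one;
Stirling is applied to the remaining `N - 1`. -/
theorem numRooted_isEquivalent {p q : ℕ} (hp : 2 ≤ p) (hq : 2 ≤ q) (hpq : 6 ≤ p * q) :
    (fun k : ℕ => (numRooted p q (p.lcm q * k) : ℝ)) ~[atTop]
      fun k : ℕ => asympC p q *
        (k : ℝ) ^ (((numParams p q : ℝ) - 1) * (k : ℝ) - asympC₀ p q) *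
        Real.exp (asympC₁ p q * (k : ℝ)) := by
  have hN := two_le_numParams hp hq hpq
  have hc := cConst_pos hp hq
  have h1 := coeff_logDerivSeries_isEquivalent hp hq hpq
  have h2 : (fun k : ℕ => ∏ i ∈ indices p q, (ascPochhammer ℝ k).eval (param p q i)) ~[atTop]
      fun k : ℕ => ∏ i ∈ indices p q,
        ((k : ℝ) ^ (param p q i - 1) * (k.factorial : ℝ) / Real.Gamma (param p q i)) :=
    IsEquivalent.finsetProd fun i hi => ascPochhammer_isEquivalent (param_pos hp hq hi)
  have h3 := Stirling.factorial_isEquivalent_stirling.pow (numParams p q - 1)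
  have h4 : (fun k : ℕ => (p.lcm q : ℝ) * cConst p q ^ k * k *
      ∏ i ∈ indices p q, ((k : ℝ) ^ (param p q i - 1) / Real.Gamma (param p q i))) ~[atTop]
    _ := IsEquivalent.refl
  have h5 : (fun k : ℕ => (p.lcm q : ℝ) * cConst p q ^ k) ~[atTop] _ := IsEquivalent.refl
  have h6 : (fun k : ℕ => (k : ℝ) / (k.factorial : ℝ)) ~[atTop] _ := IsEquivalent.refl
  have hA : (fun k : ℕ => (numRooted p q (p.lcm q * k) : ℝ)) ~[atTop]
      (fun k : ℕ => (p.lcm q : ℝ) * cConst p q ^ k) * ((fun k : ℕ => (k : ℝ) / (k.factorial : ℝ)) *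
        fun k : ℕ => ∏ i ∈ indices p q,
        ((k : ℝ) ^ (param p q i - 1) * (k.factorial : ℝ) / Real.Gamma (param p q i))) := by
    refine IsEquivalent.congr_left (h5.mul (h1.trans ?_)) (Eventually.of_forall fun k => ?_)
    · exact (h6.mul h2).congr_left (Eventually.of_forall fun k => by
        simp only [Pi.mul_apply]
        rw [coeff_fSeries]
        ring)
    · simp only [Pi.mul_apply]
      rw [numRooted_lcm_mul hp hq hpq]
      ring
  refine hA.trans (((h4.mul h3).congr_left (Eventually.of_forall fun k => ?_)).congr_right ?_)
  · simp only [Pi.mul_apply, Pi.pow_apply]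
    simp only [Finset.prod_div_distrib, Finset.prod_mul_distrib, Finset.prod_const]
    rw [← numParams, ← Nat.sub_add_cancel (show 1 ≤ numParams p q by omega), pow_succ,
      Nat.add_sub_cancel]
    have : (k.factorial : ℝ) ≠ 0 := by positivity
    field_simp
  · filter_upwards [eventually_gt_atTop 0] with k hk
    have hk' : (0 : ℝ) < k := Nat.cast_pos.2 hk
    have hcast : ((numParams p q - 1 : ℕ) : ℝ) = (numParams p q : ℝ) - 1 := by
      rw [Nat.cast_sub (by omega), Nat.cast_one]
    have e1 : cConst p q ^ k = Real.exp (k * Real.log (cConst p q)) := by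
      rw [← Real.rpow_natCast, Real.rpow_def_of_pos hc, mul_comm]
    have e2 : ∏ i ∈ indices p q, ((k : ℝ) ^ (param p q i - 1) / Real.Gamma (param p q i)) =
        Real.exp (Real.log k * (∑ i ∈ indices p q, param p q i - numParams p q)) /
          ∏ i ∈ indices p q, Real.Gamma (param p q i) := by
      rw [Finset.prod_div_distrib]
      simp only [Real.rpow_def_of_pos hk']
      rw [← Real.exp_sum, ← Finset.mul_sum, Finset.sum_sub_distrib, Finset.sum_const,
        ← numParams, nsmul_one]
    have e3 : (√(2 * (k : ℝ) * Real.pi) * ((k : ℝ) / Real.exp 1) ^ k) ^ (numParams p q - 1) =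
        (2 * Real.pi) ^ (((numParams p q : ℝ) - 1) / 2) *
          Real.exp (Real.log k * (((numParams p q : ℝ) - 1) / 2)) *
          Real.exp (((numParams p q : ℝ) - 1) * (k * (Real.log k - 1))) := by
      have hpi := Real.pi_pos
      have hbase : (k : ℝ) / Real.exp 1 = Real.exp (Real.log k - 1) := by
        rw [Real.exp_sub, Real.exp_log hk']
      rw [mul_pow, hbase, ← Real.exp_nat_mul, ← Real.exp_nat_mul, hcast, Real.sqrt_eq_rpow,
        ← Real.rpow_mul_natCast (by positivity), hcast,
        show 2 * (k : ℝ) * Real.pi = (2 * Real.pi) * k by ring,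
        Real.mul_rpow (by positivity) hk'.le, Real.rpow_def_of_pos hk']
      ring_nf
    have e4 : (k : ℝ) = Real.exp (Real.log k) := (Real.exp_log hk').symm
    simp only [Pi.mul_apply, Pi.pow_apply]
    rw [e1, e2, e3, asympC, Real.rpow_def_of_pos hk', asympC₀, asympC₁]
    -- Apart from `(N - 1) k`, the powers of `k` collect to `1 + (∑ aᵢ - N) + (N - 1)/2 = -c₀`.
    have e5 : Real.exp (k * Real.log (cConst p q)) * k *
        Real.exp (Real.log k * (∑ i ∈ indices p q, param p q i - numParams p q)) *
        (Real.exp (Real.log k * (((numParams p q : ℝ) - 1) / 2)) *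
          Real.exp (((numParams p q : ℝ) - 1) * (k * (Real.log k - 1)))) =
        Real.exp (Real.log k * (((numParams p q : ℝ) - 1) * k -
          (((numParams p q : ℝ) - 1) / 2 - ∑ i ∈ indices p q, param p q i))) *
          Real.exp ((1 + Real.log (cConst p q) - numParams p q) * k) := by
      nth_rewrite 2 [e4]
      simp only [← Real.exp_add]
      congr 1
      ring
    linear_combination ((2 * Real.pi) ^ (((numParams p q : ℝ) - 1) / 2) * (p.lcm q : ℝ) /
      ∏ i ∈ indices p q, Real.Gamma (param p q i)) * e5

end

/-! ### Algebraic power series converge near 0 -/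

/-- The sum of the norms of the first `n` terms of a power series at radius `ρ`. -/
noncomputable def truncNorm (ρ : ℝ) (n : ℕ) (u : PowerSeries ℂ) : ℝ :=
  ∑ i ∈ Finset.range n, ‖PowerSeries.coeff i u‖ * ρ ^ i

section truncNorm

variable {ρ : ℝ}

theorem truncNorm_nonneg (hρ : 0 ≤ ρ) (n : ℕ) (u : PowerSeries ℂ) : 0 ≤ truncNorm ρ n u :=
  Finset.sum_nonneg fun _ _ => by positivity

theorem truncNorm_add_le (hρ : 0 ≤ ρ) (n : ℕ) (u v : PowerSeries ℂ) :
    truncNorm ρ n (u + v) ≤ truncNorm ρ n u + truncNorm ρ n v := by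
  rw [truncNorm, truncNorm, truncNorm, ← Finset.sum_add_distrib]
  refine Finset.sum_le_sum fun i _ => ?_
  rw [map_add, ← add_mul]
  exact mul_le_mul_of_nonneg_right (norm_add_le _ _) (by positivity)

theorem truncNorm_sum_le (hρ : 0 ≤ ρ) (n : ℕ) {ι : Type*} (s : Finset ι)
    (u : ι → PowerSeries ℂ) :
    truncNorm ρ n (∑ j ∈ s, u j) ≤ ∑ j ∈ s, truncNorm ρ n (u j) := by
  refine Finset.le_sum_of_subadditive _ ?_ (fun x y => truncNorm_add_le hρ n x y) s u
  simp [truncNorm]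

/-- The product of norms sums over the square `k, l < n`, which contains the triangle `k + l < n`.
Finite truncation keeps the norm submultiplicative without assuming convergence. -/
theorem truncNorm_mul_le (hρ : 0 ≤ ρ) (n : ℕ) (u v : PowerSeries ℂ) :
    truncNorm ρ n (u * v) ≤ truncNorm ρ n u * truncNorm ρ n v := by
  have h1 : truncNorm ρ n (u * v) ≤ ∑ i ∈ Finset.range n, ∑ k ∈ Finset.range (i + 1),
      (‖PowerSeries.coeff k u‖ * ρ ^ k) * (‖PowerSeries.coeff (i - k) v‖ * ρ ^ (i - k)) := by
    refine Finset.sum_le_sum fun i _ => ?_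
    rw [PowerSeries.coeff_mul, Finset.Nat.sum_antidiagonal_eq_sum_range_succ_mk]
    refine (mul_le_mul_of_nonneg_right (norm_sum_le _ _) (by positivity)).trans ?_
    rw [Finset.sum_mul]
    refine Finset.sum_le_sum fun k hk => le_of_eq ?_
    rw [Finset.mem_range] at hk
    rw [norm_mul, ← Nat.add_sub_cancel' (Nat.lt_succ_iff.1 hk), pow_add, Nat.add_sub_cancel_left]
    ring
  refine h1.trans ?_
  rw [Finset.sum_range_diag_flip n fun k l =>
    (‖PowerSeries.coeff k u‖ * ρ ^ k) * (‖PowerSeries.coeff l v‖ * ρ ^ l), truncNorm, truncNorm,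
    Finset.sum_mul_sum]
  refine Finset.sum_le_sum fun k _ => ?_
  refine Finset.sum_le_sum_of_subset_of_nonneg (Finset.range_mono (Nat.sub_le n k)) ?_
  exact fun _ _ _ => by positivity

theorem truncNorm_one_le (n : ℕ) : truncNorm ρ n 1 ≤ 1 := by
  cases n with
  | zero => simp [truncNorm]
  | succ n => rw [truncNorm, Finset.sum_range_succ']; simp [PowerSeries.coeff_one]

theorem truncNorm_pow_le (hρ : 0 ≤ ρ) (n : ℕ) (u : PowerSeries ℂ) (j : ℕ) :
    truncNorm ρ n (u ^ j) ≤ truncNorm ρ n u ^ j := by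
  induction j with
  | zero => simpa using truncNorm_one_le n
  | succ j ih =>
    rw [pow_succ, pow_succ]
    exact (truncNorm_mul_le hρ n _ _).trans
      (mul_le_mul_of_nonneg_right ih (truncNorm_nonneg hρ n u))

theorem truncNorm_succ_X_mul (n : ℕ) (u : PowerSeries ℂ) :
    truncNorm ρ (n + 1) (PowerSeries.X * u) = ρ * truncNorm ρ n u := by
  rw [truncNorm, truncNorm, Finset.sum_range_succ', Finset.mul_sum]
  simp only [PowerSeries.coeff_succ_X_mul, PowerSeries.coeff_zero_X_mul, norm_zero, zero_mul,
    add_zero]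
  exact Finset.sum_congr rfl fun i _ => by ring

theorem truncNorm_C_le (n : ℕ) (c : ℂ) : truncNorm ρ n (PowerSeries.C c) ≤ ‖c‖ := by
  cases n with
  | zero => simp [truncNorm]
  | succ n => rw [truncNorm, Finset.sum_range_succ']; simp [PowerSeries.coeff_C]

theorem coeff_algebraMap (a : Polynomial ℂ) (i : ℕ) :
    PowerSeries.coeff i (algebraMap (Polynomial ℂ) (PowerSeries ℂ) a) = a.coeff i := by
  simp [PowerSeries.algebraMap_apply']

/-- The sum of the norms of the coefficients of a polynomial. -/
noncomputable def coeffNorm (a : Polynomial ℂ) : ℝ := ∑ i ∈ a.support, ‖a.coeff i‖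

theorem coeffNorm_nonneg (a : Polynomial ℂ) : 0 ≤ coeffNorm a :=
  Finset.sum_nonneg fun _ _ => norm_nonneg _

theorem truncNorm_algebraMap_le (hρ : 0 ≤ ρ) (hρ1 : ρ ≤ 1) (n : ℕ) (a : Polynomial ℂ) :
    truncNorm ρ n (algebraMap (Polynomial ℂ) (PowerSeries ℂ) a) ≤ coeffNorm a := by
  have h1 : truncNorm ρ n (algebraMap (Polynomial ℂ) (PowerSeries ℂ) a) ≤
      ∑ i ∈ Finset.range n, ‖a.coeff i‖ := by
    refine Finset.sum_le_sum fun i _ => ?_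
    rw [coeff_algebraMap]
    exact mul_le_of_le_one_right (norm_nonneg _) (pow_le_one₀ hρ hρ1)
  refine h1.trans ((Finset.sum_le_sum_of_subset_of_nonneg
    (Finset.subset_union_left (s₂ := a.support)) fun _ _ _ => norm_nonneg _).trans ?_)
  refine (Finset.sum_subset Finset.subset_union_right fun i _ hi => ?_).ge
  rw [Polynomial.notMem_support_iff.1 hi, norm_zero]

/-- A power series solving `t = t₀ + z Q(z, t)` converges near `0`. -/
theorem exists_truncNorm_le_of_eq {t : PowerSeries ℂ} {t₀ : ℂ}
    {Q : Polynomial (Polynomial ℂ)}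
    (h : t = PowerSeries.C t₀ + PowerSeries.X * Polynomial.aeval t Q) :
    ∃ ρ : ℝ, 0 < ρ ∧ ρ ≤ 1 ∧ ∃ M : ℝ, ∀ n, truncNorm ρ n t ≤ M := by
  -- `K` bounds `Q(z, t)` when the norm of `t` is at most `M`, and `ρ = 1/(K + 1)` makes `ρ K ≤ 1`.
  -- The factor `z` means that `n + 1` terms of `t` need only `n` terms of `Q(z, t)`, so the bound
  -- `M` propagates by induction.
  set M : ℝ := ‖t₀‖ + 1 with hM
  set K : ℝ := ∑ j ∈ Finset.range (Q.natDegree + 1), coeffNorm (Q.coeff j) * M ^ j with hK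
  have hM0 : 0 ≤ M := by positivity
  have hK0 : 0 ≤ K := Finset.sum_nonneg fun j _ =>
    mul_nonneg (coeffNorm_nonneg _) (pow_nonneg hM0 j)
  have hρ : 0 < 1 / (K + 1) := by positivity
  have hρ1 : 1 / (K + 1) ≤ 1 := by
    rw [div_le_one (by positivity)]
    linarith
  refine ⟨1 / (K + 1), hρ, hρ1, M, fun n => ?_⟩
  set ρ := 1 / (K + 1) with hρdef
  induction n with
  | zero => simpa [truncNorm] using hM0
  | succ n ih =>
    have hQ : truncNorm ρ n (Polynomial.aeval t Q) ≤ K := by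
      rw [Polynomial.aeval_eq_sum_range, hK]
      refine (truncNorm_sum_le hρ.le n _ _).trans (Finset.sum_le_sum fun j _ => ?_)
      rw [Algebra.smul_def]
      refine (truncNorm_mul_le hρ.le n _ _).trans ?_
      refine mul_le_mul (truncNorm_algebraMap_le hρ.le hρ1 n _) ?_
        (truncNorm_nonneg hρ.le n _) (coeffNorm_nonneg _)
      exact (truncNorm_pow_le hρ.le n t j).trans
        (pow_le_pow_left₀ (truncNorm_nonneg hρ.le n t) ih j)
    calc truncNorm ρ (n + 1) t
        = truncNorm ρ (n + 1) (PowerSeries.C t₀ + PowerSeries.X * Polynomial.aeval t Q) := by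
          rw [← h]
      _ ≤ ‖t₀‖ + ρ * truncNorm ρ n (Polynomial.aeval t Q) := by
        refine (truncNorm_add_le hρ.le _ _ _).trans ?_
        rw [truncNorm_succ_X_mul]
        exact add_le_add_left (truncNorm_C_le _ _) _
      _ ≤ ‖t₀‖ + ρ * K := by gcongr
      _ ≤ M := by
        rw [hM, hρdef, one_div_mul_eq_div]
        gcongr
        rw [div_le_one (by positivity)]
        linarith

/-- For an annihilating polynomial of least degree, the derivative is non-zero of smaller degree, so
it cannot annihilate `y`. -/
theorem exists_minimal_root {y : PowerSeries ℂ} (h : IsAlgebraic (Polynomial ℂ) y) :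
    ∃ P : Polynomial (Polynomial ℂ), Polynomial.aeval y P = 0 ∧
      Polynomial.aeval y (Polynomial.derivative P) ≠ 0 := by
  classical
  have hex : ∃ n, ∃ P : Polynomial (Polynomial ℂ), P ≠ 0 ∧ Polynomial.aeval y P = 0 ∧
      P.natDegree = n := by
    obtain ⟨P, h0, h1⟩ := h
    exact ⟨_, P, h0, h1, rfl⟩
  obtain ⟨P, h0, h1, hn⟩ := Nat.find_spec hex
  refine ⟨P, h1, fun hd => ?_⟩
  have hinj : Function.Injective (algebraMap (Polynomial ℂ) (PowerSeries ℂ)) := by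
    intro a b hab
    ext i
    rw [← coeff_algebraMap, hab, coeff_algebraMap]
  have hdeg : P.natDegree ≠ 0 := by
    intro hz
    rw [Polynomial.eq_C_of_natDegree_eq_zero hz, Polynomial.aeval_C,
      map_eq_zero_iff _ hinj] at h1
    exact h0 (by rw [Polynomial.eq_C_of_natDegree_eq_zero hz, h1, map_zero])
  have hd0 : Polynomial.derivative P ≠ 0 := fun hz =>
    hdeg (Polynomial.derivative_eq_zero.1 hz)
  refine Nat.find_min hex ?_ ⟨Polynomial.derivative P, hd0, hd, rfl⟩
  rw [← hn]
  exact Polynomial.natDegree_derivative_lt hdeg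

/-- An algebraic power series converges near `0`. -/
theorem IsAlgebraic.exists_truncNorm_le {y : PowerSeries ℂ}
    (h : IsAlgebraic (Polynomial ℂ) y) :
    ∃ ρ : ℝ, 0 < ρ ∧ ∃ M : ℝ, ∀ n, truncNorm ρ n y ≤ M := by
  obtain ⟨P, hP, hP'⟩ := exists_minimal_root h
  set ι := algebraMap (Polynomial ℂ) (PowerSeries ℂ) with hι
  have hιX : ι Polynomial.X = PowerSeries.X := by
    ext i
    rw [coeff_algebraMap, Polynomial.coeff_X, PowerSeries.coeff_X]
    simp [eq_comm]
  have hιC : ∀ c, ι (Polynomial.C c) = PowerSeries.C c := by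
    intro c
    ext i
    rw [coeff_algebraMap, Polynomial.coeff_C, PowerSeries.coeff_C]
  -- Newton-Hensel reduction: `m` is the order of `P'(y)`. Approximating `y` by a polynomial `u`
  -- modulo `X^(m+1)` preserves this order, so `P'(u) = X^m b` with `b(0) ≠ 0`.
  obtain ⟨m, hm, hlt⟩ : ∃ m,
      PowerSeries.coeff m (Polynomial.aeval y (Polynomial.derivative P)) ≠ 0 ∧
      ∀ i < m, PowerSeries.coeff i (Polynomial.aeval y (Polynomial.derivative P)) = 0 :=
    ⟨_, PowerSeries.coeff_order hP', fun i hi => PowerSeries.coeff_of_lt_order i (by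
      rw [← ENat.natCast_toNat (PowerSeries.order_eq_top.not.2 hP')]
      exact_mod_cast hi)⟩
  set u : Polynomial ℂ := PowerSeries.trunc (m + 1) y with hu
  obtain ⟨t, ht⟩ : PowerSeries.X ^ (m + 1) ∣ y - ι u := by
    rw [PowerSeries.X_pow_dvd_iff]
    intro i hi
    rw [map_sub, coeff_algebraMap, hu, PowerSeries.coeff_trunc, if_pos hi, sub_self]
  have hdvd : PowerSeries.X ^ (m + 1) ∣ Polynomial.aeval y (Polynomial.derivative P) -
      ι ((Polynomial.derivative P).eval u) := by
    have h1 := Polynomial.sub_dvd_eval_sub y (ι u) ((Polynomial.derivative P).map ι)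
    rw [Polynomial.eval_map_algebraMap, Polynomial.eval_map_algebraMap,
      Polynomial.aeval_algebraMap_apply, Polynomial.coe_aeval_eq_eval] at h1
    exact (Dvd.intro _ ht.symm).trans h1
  rw [PowerSeries.X_pow_dvd_iff] at hdvd
  simp only [map_sub, hι, coeff_algebraMap, sub_eq_zero] at hdvd
  obtain ⟨b, hb⟩ : Polynomial.X ^ m ∣ (Polynomial.derivative P).eval u := by
    rw [Polynomial.X_pow_dvd_iff]
    intro i hi
    rw [← hdvd i (by omega), hlt i hi]
  have hb0 : b.coeff 0 ≠ 0 := by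
    rw [hdvd m (by omega), hb] at hm
    simpa [Polynomial.coeff_X_pow_mul'] using hm
  set T := Polynomial.taylor u P with hT
  set R := T.divX.divX with hR
  have hTeq : T = (R * Polynomial.X + Polynomial.C (T.coeff 1)) * Polynomial.X +
      Polynomial.C (T.coeff 0) := by
    have h1 : T.divX.coeff 0 = T.coeff 1 := Polynomial.coeff_divX
    rw [hR, ← h1, Polynomial.divX_mul_X_add, Polynomial.divX_mul_X_add]
  have hTev : Polynomial.aeval (PowerSeries.X ^ (m + 1) * t) T = 0 := by
    rw [← ht, hT, Polynomial.taylor_apply, Polynomial.aeval_comp]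
    simp only [map_add, Polynomial.aeval_X, Polynomial.aeval_C, ← hι, sub_add_cancel]
    exact hP
  set r := Polynomial.aeval (PowerSeries.X ^ (m + 1) * t) R with hr
  -- Taylor expansion of `P(y) = 0` at `u`, with `y = u + X^(m+1) t` and quadratic remainder `r`.
  -- The other terms being divisible by `X^(2m+1)`, so is `P(u)`, and dividing leaves `a + b t + X r
  -- t² = 0`.
  have heq : (r * (PowerSeries.X ^ (m + 1) * t) + PowerSeries.X ^ m * ι b) *
      (PowerSeries.X ^ (m + 1) * t) + ι (P.eval u) = 0 := by
    rw [hTeq, hT, Polynomial.taylor_coeff_zero, Polynomial.taylor_coeff_one, hb] at hTev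
    simp only [map_add, map_mul, map_pow, Polynomial.aeval_X, Polynomial.aeval_C, ← hι,
      hιX] at hTev
    exact hTev
  obtain ⟨a, ha⟩ : Polynomial.X ^ (2 * m + 1) ∣ P.eval u := by
    have h1 : PowerSeries.X ^ (2 * m + 1) ∣ ι (P.eval u) :=
      ⟨-(r * PowerSeries.X * t ^ 2 + ι b * t), by linear_combination heq⟩
    rw [PowerSeries.X_pow_dvd_iff] at h1
    rw [Polynomial.X_pow_dvd_iff]
    exact fun i hi => by rw [← coeff_algebraMap, h1 i hi]
  have hred : ι a + ι b * t + PowerSeries.X * (r * t ^ 2) = 0 := by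
    rw [ha, map_mul, map_pow, hιX] at heq
    have h1 : (PowerSeries.X : PowerSeries ℂ) ^ (2 * m + 1) *
        (ι a + ι b * t + PowerSeries.X * (r * t ^ 2)) = 0 := by
      linear_combination heq
    exact (mul_eq_zero.1 h1).resolve_left (pow_ne_zero _ PowerSeries.X_ne_zero)
  have hab : ∀ a : Polynomial ℂ, ι a = PowerSeries.X * ι a.divX + PowerSeries.C (a.coeff 0) := by
    intro a
    conv_lhs => rw [← Polynomial.divX_mul_X_add a]
    rw [map_add, map_mul, hιX, hιC, mul_comm]
  have hb1 : PowerSeries.C (b.coeff 0)⁻¹ * PowerSeries.C (b.coeff 0) = (1 : PowerSeries ℂ) := by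
    rw [← map_mul, inv_mul_cancel₀ hb0, map_one]
  obtain ⟨R', hR'⟩ : ∃ R', Polynomial.aeval t R' = r := by
    refine ⟨R.comp (Polynomial.C (Polynomial.X ^ (m + 1)) * Polynomial.X), ?_⟩
    rw [Polynomial.aeval_comp, hr]
    congr 2
    rw [map_mul, Polynomial.aeval_C, Polynomial.aeval_X, map_pow, ← hι, hιX]
  -- Solving for `t` with the unit `b(0)` and moving the non-constant parts of `a` and `b` into the
  -- `X` term gives the fixed-point form.
  have hfix : t = PowerSeries.C (-(b.coeff 0)⁻¹ * a.coeff 0) + PowerSeries.X *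
      Polynomial.aeval t (Polynomial.C (Polynomial.C (-(b.coeff 0)⁻¹)) *
        (Polynomial.C a.divX + Polynomial.C b.divX * Polynomial.X + R' * Polynomial.X ^ 2)) := by
    rw [hab a, hab b] at hred
    simp only [map_mul, map_add, map_pow, Polynomial.aeval_C, Polynomial.aeval_X, ← hι, hιC, hR']
    rw [map_neg]
    linear_combination PowerSeries.C (b.coeff 0)⁻¹ * hred - t * hb1
  obtain ⟨ρ, hρ, hρ1, M, hM⟩ := exists_truncNorm_le_of_eq hfix
  refine ⟨ρ, hρ, coeffNorm u + coeffNorm (Polynomial.X ^ (m + 1)) * M, fun n => ?_⟩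
  have hy : y = ι u + ι (Polynomial.X ^ (m + 1)) * t := by
    rw [map_pow, hιX, ← ht]
    ring
  rw [hy]
  refine (truncNorm_add_le hρ.le n _ _).trans
    (add_le_add (truncNorm_algebraMap_le hρ.le hρ1 n u) ?_)
  exact (truncNorm_mul_le hρ.le n _ _).trans (mul_le_mul
    (truncNorm_algebraMap_le hρ.le hρ1 n _) (hM n) (truncNorm_nonneg hρ.le n t)
    (coeffNorm_nonneg _))

end truncNorm

/-! ### Transcendence and conclusion -/

theorem transcendental_Hcirc {p q : ℕ} (hp : 2 ≤ p) (hq : 2 ≤ q) (hpq : 6 ≤ p * q) :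
    Transcendental (Polynomial ℂ) (Hcirc ℂ p q) := by
  intro halg
  obtain ⟨ρ, hρ, M, hM⟩ := IsAlgebraic.exists_truncNorm_le halg
  have hc := cConst_pos hp hq
  -- The value of `x = c z^L` at `z = ρ`: boundedness of the terms of `H°` at `ρ` becomes
  -- boundedness of `A_k s^k`.
  set s : ℝ := cConst p q * ρ ^ p.lcm q with hs
  have hs0 : 0 < s := by positivity
  have hbound : ∀ k : ℕ, PowerSeries.coeff (k + 1) (fSeries p q) * s ^ (k + 1) ≤ M := by
    intro k
    have h1 : (numRooted p q (p.lcm q * (k + 1)) : ℝ) * ρ ^ (p.lcm q * (k + 1)) ≤ M := by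
      refine le_trans ?_ (hM (p.lcm q * (k + 1) + 1))
      rw [truncNorm, Finset.sum_range_succ]
      refine le_trans (le_of_eq ?_) (le_add_of_nonneg_left
        (Finset.sum_nonneg fun i _ => by positivity))
      rw [Hcirc, PowerSeries.coeff_mk, Complex.norm_natCast]
    refine le_trans ?_ h1
    have hL : (1 : ℝ) ≤ p.lcm q :=
      Nat.one_le_cast.2 (Nat.lcm_pos (show 0 < p by omega) (show 0 < q by omega))
    have h2 := coeff_fSeries_le_coeff_logDerivSeries hp hq hpq k
    have h3 := (coeff_fSeries_pos hp hq (k + 1)).trans_le h2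
    rw [numRooted_lcm_mul hp hq hpq, hs, mul_pow, ← pow_mul, ← mul_assoc]
    refine mul_le_mul_of_nonneg_right ?_ (by positivity)
    calc PowerSeries.coeff (k + 1) (fSeries p q) * cConst p q ^ (k + 1)
        ≤ 1 * (cConst p q ^ (k + 1) * PowerSeries.coeff (k + 1) (logDerivSeries p q)) := by
          rw [one_mul, mul_comm]
          exact mul_le_mul_of_nonneg_left h2 (by positivity)
      _ ≤ _ := mul_le_mul_of_nonneg_right hL (by positivity)
  -- Beyond `k₀` the coefficient ratio is at least `2 / s`, so the terms `A_k s^k` at least double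
  -- at every step.
  obtain ⟨k₀, hk₀⟩ := Filter.eventually_atTop.1
    ((tendsto_coeffRatio hp hq hpq).eventually_ge_atTop (2 / s))
  have htend := tendsto_atTop_of_geom_le
    (v := fun j => PowerSeries.coeff (k₀ + j + 1) (fSeries p q) * s ^ (k₀ + j + 1)) (c := 2)
    (mul_pos (coeff_fSeries_pos hp hq _) (by positivity)) one_lt_two fun j => by
      have h1 := hk₀ (k₀ + j + 1) (by omega)
      rw [div_le_iff₀ hs0] at h1
      have h2 := coeff_fSeries_pos hp hq (k₀ + j + 1)
      rw [← add_assoc k₀ j 1, coeff_fSeries_succ_eq p q (k₀ + j + 1), pow_succ s (k₀ + j + 1)]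
      have h3 : 0 < PowerSeries.coeff (k₀ + j + 1) (fSeries p q) * s ^ (k₀ + j + 1) := by
        positivity
      nlinarith
  obtain ⟨j, hj⟩ := (htend.eventually_gt_atTop M).exists
  exact absurd (hbound (k₀ + j)) (not_le.2 hj)

end PQHypermap

theorem mainTheorem1 (p q : ℕ) (hp : 2 ≤ p) (hq : 2 ≤ q) (hpq : 6 ≤ p * q) :
    -- the constants: `N = 1 + ((p - 1) (q - 1) - 1) / gcd(p, q)` and
    -- `c > 0`, `c ^ gcd(p, q) = lcm(p, q) ^ ((p - 1) (q - 1) - 1)`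
    ((PQHypermap.numParams p q : ℝ) =
        1 + (((p : ℝ) - 1) * ((q : ℝ) - 1) - 1) / (p.gcd q : ℝ)) ∧
    0 < PQHypermap.cConst p q ∧
    PQHypermap.cConst p q ^ p.gcd q = (p.lcm q : ℝ) ^ ((p - 1) * (q - 1) - 1) ∧
    -- `f` has constant term `1` and radius of convergence `0`
    PowerSeries.constantCoeff (PQHypermap.fSeries p q) = 1 ∧
    (FormalMultilinearSeries.ofScalars ℝ
        (fun k : ℕ => PowerSeries.coeff k (PQHypermap.fSeries p q))).radius = 0 ∧
    -- `H°(z) = lcm(p, q) · x f'(x) / f(x)` with `x = c z ^ lcm(p, q)`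
    PQHypermap.Hcirc ℝ p q =
      (p.lcm q : ℝ) •
        (PowerSeries.subst
          (PowerSeries.C (PQHypermap.cConst p q) * PowerSeries.X ^ p.lcm q : PowerSeries ℝ)
          (PowerSeries.X * PowerSeries.derivative ℝ (PQHypermap.fSeries p q) *
            (PQHypermap.fSeries p q)⁻¹) : PowerSeries ℝ) ∧
    -- `H°` is transcendental
    Transcendental (Polynomial ℂ) (PQHypermap.Hcirc ℂ p q) ∧
    -- the non-zero coefficients are those at `z ^ (lcm(p, q) k)`, `k ≥ 1`, and their asymptotics
    (∀ n : ℕ, PQHypermap.numRooted p q n ≠ 0 ↔ 0 < n ∧ p.lcm q ∣ n) ∧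
    Asymptotics.IsEquivalent Filter.atTop
      (fun k : ℕ => (PQHypermap.numRooted p q (p.lcm q * k) : ℝ))
      (fun k : ℕ => PQHypermap.asympC p q *
        (k : ℝ) ^ (((PQHypermap.numParams p q : ℝ) - 1) * (k : ℝ) - PQHypermap.asympC₀ p q) *
        Real.exp (PQHypermap.asympC₁ p q * (k : ℝ))) := by
  have hp0 : 0 < p := by omega
  have hq0 : 0 < q := by omega
  exact ⟨PQHypermap.numParams_eq hp0 hq0, PQHypermap.cConst_pos hp hq,
    PQHypermap.cConst_pow_gcd hp hq hpq, PQHypermap.constantCoeff_fSeries p q,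
    PQHypermap.radius_fSeries hp hq hpq, PQHypermap.Hcirc_eq_subst hp hq hpq,
    PQHypermap.transcendental_Hcirc hp hq hpq, PQHypermap.numRooted_ne_zero_iff hp hq hpq,
    PQHypermap.numRooted_isEquivalent hp hq hpq⟩
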